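/- Let $\Gamma$ be a (connected) simply laced Dynkin diagram of finite type, i.e. $A_n$ ($n\ge 1$), $D_n$ ($n\ge 4$), $E_6$, $E_7$ or $E_8$, with vertex set $\Pi$, and let $K$ be a field of characteristic $\neq 2$. Let $\mathcal F$ be the quotient of the free Lie algebra over $K$ on $\Pi$ by the ideal generated by the brackets $[x,y]$ for non-adjacent $x,y\in\Pi$, and let $\mathcal L(0)$ (the sandwich algebra) be the quotient of $\mathcal F$ by the ideal generated by all $[x,[x,y]]$ with $x\in\Pi$, $y\in\mathcal F$. Let $\mathfrak g_{\mathrm{KM}}$ be the complex Lie algebra with generators $E_x,H_x,F_x$ ($x\in\Pi$) and the Serre relations for the Cartan matrix of $\Gamma$ (entries $2$ on the diagonal, $-1$ for adjacent vertices, $0$ otherwise), graded by $\mathbb Z^\Pi$ with $E_x,H_x,F_x$ of weights $\alpha_x,0,-\alpha_x$, where $\alpha_x$ is the standard basis vector of $x$. Let $\Phi\subset\mathbb Z^\Pi\setminus\{0\}$ be the set of nonzero weights $\beta$ with $(\mathfrak g_{\mathrm{KM}})_\beta\neq 0$, and $\Phi_+=\Phi\cap\mathbb N^\Pi$. A Chevalley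 basis of $\mathfrak g_{\mathrm{KM}}$ is a basis consisting of the $H_x$ $(x\in\Pi)$ and one vector $E_\beta\in(\mathfrak g_{\mathrm{KM}})_\beta$ for each $\beta\in\Phi$, with $E_{\alpha_x}=E_x$, $E_{-\alpha_x}=F_x$, $[E_\beta,E_{-\beta}]=\sum_x\beta_xH_x$, and $[E_\beta,E_\gamma]=\pm(p+1)E_{\beta+\gamma}$ whenever $\beta,\gamma,\beta+\gamma\in\Phi$, where $p\geq 0$ is such that $\gamma,\gamma-\beta,\dots,\gamma-p\beta\in\Phi$ and $\gamma-(p+1)\beta\notin\Phi$. Its $\mathbb Z$-span is a Lie ring, and tensoring this with $K$ gives the Chevalley algebra $\mathfrak g$ of type $\Gamma$ over $K$. Write $E_\beta^0=1\otimes E_\beta$ and $E_x^0=1\otimes E_x$ in $\mathfrak g$, and let $\mathfrak n_+$ be the Lie subalgebra of $\mathfrak g$ generated by the $E_x^0$, $x\in\Pi$. **Theorem.** The algebra $\mathfrak g_{\mathrm{KM}}$ has a Chevalley basis. For every Chevalley basis, $\mathfrak n_+$ is the $K$-span of the $E_\beta^0$ with $\beta\in\Phi_+$, and there is a unique Lie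 algebra homomorphism $\mathcal L(0)\to\mathfrak n_+$ sending (the image of) $x$ to $E_x^0$ for all $x\in\Pi$ that is bijective; that is, $x\mapsto E_x^0$ induces a unique isomorphism $\mathcal L(0)\cong\mathfrak n_+$. -/

import Mathlib

open scoped TensorProduct

namespace Sandwich

universe u v

/-! ### Simply laced Dynkin diagrams of finite type -/

/-- The path `0 - 1 - ⋯ - (n-2)` together with one further vertex `n-1`, joined to the vertex `b`
of the path. -/
def forkGraph (n b : ℕ) : SimpleGraph (Fin n) :=
  SimpleGraph.fromRel fun i j =>
    ((i : ℕ) + 1 = j ∧ (j : ℕ) + 1 < n) ∨ ((i : ℕ) = b ∧ (j : ℕ) + 1 = n)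

/-- `Γ` is one of the connected simply laced Dynkin diagrams of finite type:
`A_n` (`n ≥ 1`), `D_n` (`n ≥ 4`), `E_6`, `E_7`, `E_8`. -/
def IsFiniteSimplyLacedDynkin {V : Type v} (Γ : SimpleGraph V) : Prop :=
  (∃ n : ℕ, 1 ≤ n ∧ Nonempty (Γ ≃g SimpleGraph.pathGraph n)) ∨
  (∃ n : ℕ, 4 ≤ n ∧ Nonempty (Γ ≃g forkGraph n (n - 3))) ∨
  (∃ n : ℕ, (n = 6 ∨ n = 7 ∨ n = 8) ∧ Nonempty (Γ ≃g forkGraph n 2))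

/-! ### The algebras `F` and `L(f)` -/

section Algebras

variable (K : Type u) [Field K] {V : Type v} (Γ : SimpleGraph V)

/-- The ideal of the free Lie algebra on the vertices that is generated by the brackets `[x, y]`
of non-adjacent vertices. -/
noncomputable def commIdeal : LieIdeal K (FreeLieAlgebra K V) :=
  LieSubmodule.lieSpan K (FreeLieAlgebra K V)
    {z | ∃ x y : V, ¬ Γ.Adj x y ∧ z = ⁅FreeLieAlgebra.of K x, FreeLieAlgebra.of K y⁆}

/-- The Lie algebra `F`: generators the vertices of `Γ`, with `[x, y] = 0` for non-adjacent
`x, y`. -/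
abbrev GraphLieAlgebra : Type (max u v) := FreeLieAlgebra K V ⧸ commIdeal K Γ

/-- The generator of `F` that belongs to the vertex `x`. -/
noncomputable def graphGen (x : V) : GraphLieAlgebra K Γ :=
  LieSubmodule.Quotient.mk (FreeLieAlgebra.of K x)

variable (f : V → Module.Dual K (GraphLieAlgebra K Γ))

/-- The ideal `I(f)` of `F` generated by all `[x, [x, y]] - f_x(y) x`, for `x` a vertex and
`y ∈ F`. -/
noncomputable def extremalIdeal : LieIdeal K (GraphLieAlgebra K Γ) :=
  LieSubmodule.lieSpan K (GraphLieAlgebra K Γ)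
    {z | ∃ (x : V) (y : GraphLieAlgebra K Γ),
      z = ⁅graphGen K Γ x, ⁅graphGen K Γ x, y⁆⁆ - f x y • graphGen K Γ x}

/-- The Lie algebra `L(f) = F / I(f)`. -/
abbrev ExtremalAlgebra : Type (max u v) := GraphLieAlgebra K Γ ⧸ extremalIdeal K Γ f

/-- The image in `L(f)` of the vertex `x`. -/
noncomputable def extremalGen (x : V) : ExtremalAlgebra K Γ f :=
  LieSubmodule.Quotient.mk (graphGen K Γ x)

/-- The sandwich algebra `L(0)`. -/
abbrev SandwichAlgebra : Type (max u v) :=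
  ExtremalAlgebra K Γ (0 : V → Module.Dual K (GraphLieAlgebra K Γ))

/-- The image in `L(0)` of the vertex `x`. -/
noncomputable abbrev sandwichGen (x : V) : SandwichAlgebra K Γ := extremalGen K Γ 0 x

end Algebras

/-! ### The complex Kac-Moody algebra of `Γ` and its root system -/

section KacMoody

variable {V : Type v} [DecidableEq V] (Γ : SimpleGraph V)

open scoped Classical in
/-- The Cartan matrix of `Γ`: the Gram matrix of `⟨·,·⟩` on the simple roots. -/
noncomputable def cartanMatrix : Matrix V V ℤ := fun x y =>
  if x = y then 2 else if Γ.Adj x y then -1 else 0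

/-- The complex Kac-Moody algebra of `Γ`, by generators `E_x, H_x, F_x` and the Serre relations. -/
abbrev KacMoody : Type v := Matrix.ToLieAlgebra ℂ (cartanMatrix Γ)

/-- The images of the generators in the Kac-Moody algebra. -/
noncomputable def kmGen (g : CartanMatrix.Generators V) : KacMoody Γ :=
  (LieSubmodule.Quotient.mk (FreeLieAlgebra.of ℂ g) :
    FreeLieAlgebra ℂ (CartanMatrix.Generators V) ⧸
      CartanMatrix.Relations.toIdeal ℂ (cartanMatrix Γ))

/-- The generator `E_x`. -/
noncomputable def kmE (x : V) : KacMoody Γ := kmGen Γ (.E x)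
/-- The generator `H_x`. -/
noncomputable def kmH (x : V) : KacMoody Γ := kmGen Γ (.H x)
/-- The generator `F_x`. -/
noncomputable def kmF (x : V) : KacMoody Γ := kmGen Γ (.F x)

/-- The simple root `α_x`. -/
def simpleRoot (x : V) : V → ℤ := Pi.single x 1

/-- `IsMonomial Γ β v`: `v` is an iterated bracket of generators of total weight `β`, where
`E_x, H_x, F_x` have weights `α_x, 0, -α_x`. -/
inductive IsMonomial : (V → ℤ) → KacMoody Γ → Prop
  | E (x : V) : IsMonomial (simpleRoot x) (kmE Γ x)
  | H (x : V) : IsMonomial 0 (kmH Γ x)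
  | F (x : V) : IsMonomial (-simpleRoot x) (kmF Γ x)
  | lie {β γ : V → ℤ} {v w : KacMoody Γ} :
      IsMonomial β v → IsMonomial γ w → IsMonomial (β + γ) ⁅v, w⁆

/-- The component of weight `β` of the Kac-Moody algebra in the grading by `ℤ^V`. -/
noncomputable def weightSpace (β : V → ℤ) : Submodule ℂ (KacMoody Γ) :=
  Submodule.span ℂ {v | IsMonomial Γ β v}

/-- The root system `Φ`: the nonzero weights with nonzero component. -/
def roots : Set (V → ℤ) := {β | β ≠ 0 ∧ weightSpace Γ β ≠ ⊥}

/-- The positive roots `Φ_+ = Φ ∩ ℕ^V`. -/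
def posRoots : Set (V → ℤ) := {β | β ∈ roots Γ ∧ ∀ x, 0 ≤ β x}

/-- The element `H_β = ∑ β_x H_x` (the coroot of `β`, as `Γ` is simply laced). -/
noncomputable def corootElt [Fintype V] (β : V → ℤ) : KacMoody Γ := ∑ x, β x • kmH Γ x

/-- A Chevalley basis of the Kac-Moody algebra of a simply laced diagram of finite type: it
consists of the `H_x` and of one root vector `E_β` for each root `β`, extending the generators
`E_x` and `F_x`, such that `[E_β, E_{-β}] = H_β` and
`[E_β, E_γ] = ± (p + 1) E_{β+γ}` whenever `β, γ, β + γ` are roots, where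
`γ - p β, …, γ - β, γ` are roots and `γ - (p + 1) β` is not. -/
structure ChevalleyBasis [Fintype V] where
  /-- The root vectors. -/
  rootVec : roots Γ → KacMoody Γ
  rootVec_mem : ∀ β : roots Γ, rootVec β ∈ weightSpace Γ β
  rootVec_simple : ∀ (x : V) (h : simpleRoot x ∈ roots Γ), rootVec ⟨simpleRoot x, h⟩ = kmE Γ x
  rootVec_neg_simple :
    ∀ (x : V) (h : -simpleRoot x ∈ roots Γ), rootVec ⟨-simpleRoot x, h⟩ = kmF Γ x
  linearIndependent : LinearIndependent ℂ (Sum.elim (kmH Γ) rootVec)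
  span_eq_top : Submodule.span ℂ (Set.range (Sum.elim (kmH Γ) rootVec)) = ⊤
  lie_neg : ∀ β γ : roots Γ, (γ : V → ℤ) = -β → ⁅rootVec β, rootVec γ⁆ = corootElt Γ β
  lie_add : ∀ β γ δ : roots Γ, (δ : V → ℤ) = β + γ →
    ∃ p : ℕ, (∀ j : ℕ, j ≤ p → (γ : V → ℤ) - j • (β : V → ℤ) ∈ roots Γ) ∧
      (γ : V → ℤ) - (p + 1) • (β : V → ℤ) ∉ roots Γ ∧
      (⁅rootVec β, rootVec γ⁆ = (p + 1) • rootVec δ ∨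
        ⁅rootVec β, rootVec γ⁆ = -((p + 1) • rootVec δ))

/-! #### Elementary facts needed for the `ℤ`-form -/

theorem kmGen_rel {z : FreeLieAlgebra ℂ (CartanMatrix.Generators V)}
    (hz : z ∈ CartanMatrix.Relations.toSet ℂ (cartanMatrix Γ)) :
    (LieSubmodule.Quotient.mk z : FreeLieAlgebra ℂ (CartanMatrix.Generators V) ⧸
      CartanMatrix.Relations.toIdeal ℂ (cartanMatrix Γ)) = 0 :=
  (LieSubmodule.Quotient.mk_eq_zero').2 (LieSubmodule.subset_lieSpan hz)

theorem lie_kmH_kmH (x y : V) : ⁅kmH Γ x, kmH Γ y⁆ = 0 :=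
  kmGen_rel Γ (z := CartanMatrix.Relations.HH ℂ (x, y))
    (by simp [CartanMatrix.Relations.toSet])

theorem lie_kmE_kmF (x : V) : ⁅kmE Γ x, kmF Γ x⁆ = kmH Γ x := by
  have h := kmGen_rel Γ (z := CartanMatrix.Relations.EF ℂ (x, x))
    (by simp [CartanMatrix.Relations.toSet])
  simp only [CartanMatrix.Relations.EF, Function.uncurry, if_true] at h
  exact sub_eq_zero.1 h

theorem lie_kmH_kmE (x y : V) : ⁅kmH Γ x, kmE Γ y⁆ = cartanMatrix Γ x y • kmE Γ y := by
  have h := kmGen_rel Γ (z := CartanMatrix.Relations.HE ℂ (cartanMatrix Γ) (x, y))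
    (by simp [CartanMatrix.Relations.toSet])
  simp only [CartanMatrix.Relations.HE, Function.uncurry] at h
  exact sub_eq_zero.1 h

theorem lie_kmH_kmF (x y : V) : ⁅kmH Γ x, kmF Γ y⁆ = -(cartanMatrix Γ x y • kmF Γ y) := by
  have h := kmGen_rel Γ (z := CartanMatrix.Relations.HF ℂ (cartanMatrix Γ) (x, y))
    (by simp [CartanMatrix.Relations.toSet])
  simp only [CartanMatrix.Relations.HF, Function.uncurry] at h
  exact eq_neg_of_add_eq_zero_left h

theorem lie_kmH_of_isMonomial [Fintype V] (x : V) {β : V → ℤ} {v : KacMoody Γ}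
    (hv : IsMonomial Γ β v) : ⁅kmH Γ x, v⁆ = (∑ y, cartanMatrix Γ x y * β y) • v := by
  induction hv with
  | E y => simp [lie_kmH_kmE, simpleRoot, Pi.single_apply]
  | H y => simp [lie_kmH_kmH]
  | F y => simp [lie_kmH_kmF, simpleRoot, Pi.single_apply]
  | lie _ _ h1 h2 =>
    rw [leibniz_lie, h1, h2, smul_lie, lie_smul, ← add_smul]
    simp [mul_add, Finset.sum_add_distrib]

theorem lie_kmH_of_mem [Fintype V] (x : V) {β : V → ℤ} {v : KacMoody Γ}
    (hv : v ∈ weightSpace Γ β) : ⁅kmH Γ x, v⁆ = (∑ y, cartanMatrix Γ x y * β y) • v := by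
  induction hv using Submodule.span_induction with
  | mem v hv => exact lie_kmH_of_isMonomial Γ x hv
  | zero => simp
  | add v w _ _ h1 h2 => rw [lie_add, h1, h2, smul_add]
  | smul c v _ h => rw [lie_smul, h, smul_comm]

theorem lie_mem_weightSpace {β γ : V → ℤ} {v w : KacMoody Γ}
    (hv : v ∈ weightSpace Γ β) (hw : w ∈ weightSpace Γ γ) : ⁅v, w⁆ ∈ weightSpace Γ (β + γ) := by
  induction hv using Submodule.span_induction with
  | mem v hv =>
    induction hw using Submodule.span_induction with
    | mem w hw => exact Submodule.subset_span (.lie hv hw)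
    | zero => simp
    | add a b _ _ h1 h2 => rw [lie_add]; exact add_mem h1 h2
    | smul c a _ h => rw [lie_smul]; exact Submodule.smul_mem _ c h
  | zero => simp
  | add a b _ _ h1 h2 => rw [add_lie]; exact add_mem h1 h2
  | smul c a _ h => rw [smul_lie]; exact Submodule.smul_mem _ c h

end KacMoody

/-! ### The Chevalley algebra -/

section Chevalley

variable {V : Type v} [DecidableEq V] [Fintype V] {Γ : SimpleGraph V}

namespace ChevalleyBasis

variable (c : ChevalleyBasis Γ)

/-- The elements of the Chevalley basis. -/
noncomputable abbrev vec : V ⊕ roots Γ → KacMoody Γ := Sum.elim (kmH Γ) c.rootVec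

theorem kmH_mem_span (x : V) : kmH Γ x ∈ Submodule.span ℤ (Set.range c.vec) :=
  Submodule.subset_span ⟨Sum.inl x, rfl⟩

theorem rootVec_mem_span (β : roots Γ) : c.rootVec β ∈ Submodule.span ℤ (Set.range c.vec) :=
  Submodule.subset_span ⟨Sum.inr β, rfl⟩

theorem lie_vec_mem (i j : V ⊕ roots Γ) :
    ⁅c.vec i, c.vec j⁆ ∈ Submodule.span ℤ (Set.range c.vec) := by
  have key : ∀ (x : V) (β : roots Γ),
      ⁅kmH Γ x, c.rootVec β⁆ ∈ Submodule.span ℤ (Set.range c.vec) := fun x β => by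
    rw [lie_kmH_of_mem Γ x (c.rootVec_mem β)]
    exact Submodule.smul_mem _ _ (c.rootVec_mem_span β)
  rcases i with x | β <;> rcases j with y | γ
  · simp [vec, lie_kmH_kmH]
  · exact key x γ
  · change ⁅c.rootVec β, kmH Γ y⁆ ∈ _
    rw [← lie_skew]
    exact neg_mem (key y β)
  · change ⁅c.rootVec β, c.rootVec γ⁆ ∈ _
    by_cases h0 : (γ : V → ℤ) = -β
    · rw [c.lie_neg β γ h0]
      exact sum_mem fun x _ => Submodule.smul_mem _ _ (c.kmH_mem_span x)
    by_cases hr : (β : V → ℤ) + γ ∈ roots Γ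
    · obtain ⟨p, -, -, h | h⟩ := c.lie_add β γ ⟨_, hr⟩ rfl
      · rw [h]
        exact nsmul_mem (c.rootVec_mem_span _) _
      · rw [h]
        exact neg_mem (nsmul_mem (c.rootVec_mem_span _) _)
    · have hm := lie_mem_weightSpace Γ (c.rootVec_mem β) (c.rootVec_mem γ)
      have hb : weightSpace Γ ((β : V → ℤ) + γ) = ⊥ := by
        by_contra hb
        exact hr ⟨fun h => h0 (eq_neg_of_add_eq_zero_right h), hb⟩
      rw [hb, Submodule.mem_bot] at hm
      rw [hm]
      exact zero_mem _

/-- The `ℤ`-form: the `ℤ`-span of the Chevalley basis, which is closed under the bracket. -/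
noncomputable def zForm : LieSubalgebra ℤ (KacMoody Γ) where
  toSubmodule := Submodule.span ℤ (Set.range c.vec)
  lie_mem' := by
    intro a b ha hb
    change ⁅a, b⁆ ∈ Submodule.span ℤ (Set.range c.vec)
    replace ha : a ∈ Submodule.span ℤ (Set.range c.vec) := ha
    replace hb : b ∈ Submodule.span ℤ (Set.range c.vec) := hb
    induction ha using Submodule.span_induction with
    | mem a ha =>
      obtain ⟨i, rfl⟩ := ha
      induction hb using Submodule.span_induction with
      | mem b hb =>
        obtain ⟨j, rfl⟩ := hb
        exact c.lie_vec_mem i j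
      | zero => simp
      | add v w _ _ h1 h2 => rw [_root_.lie_add]; exact add_mem h1 h2
      | smul n v _ h => rw [_root_.lie_smul]; exact Submodule.smul_mem _ n h
    | zero => simp
    | add v w _ _ h1 h2 => rw [_root_.add_lie]; exact add_mem h1 h2
    | smul n v _ h => rw [_root_.smul_lie]; exact Submodule.smul_mem _ n h

theorem rootVec_mem_zForm (β : roots Γ) : c.rootVec β ∈ c.zForm := c.rootVec_mem_span β

theorem simpleRoot_mem_roots (c : ChevalleyBasis Γ) (x : V) : simpleRoot x ∈ roots Γ := by
  refine ⟨fun h => by simpa [simpleRoot] using congrFun h x, fun h => ?_⟩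
  have hE : kmE Γ x ∈ weightSpace Γ (simpleRoot x) := Submodule.subset_span (.E x)
  rw [h, Submodule.mem_bot] at hE
  have hH : kmH Γ x = 0 := by rw [← lie_kmE_kmF, hE, zero_lie]
  exact c.linearIndependent.ne_zero (Sum.inl x) hH

theorem kmE_mem_zForm (x : V) : kmE Γ x ∈ c.zForm := by
  rw [← c.rootVec_simple x (c.simpleRoot_mem_roots x)]
  exact c.rootVec_mem_zForm _

variable (K : Type u) [Field K]

/-- The Chevalley algebra over `K`: the `ℤ`-form tensored with `K`. -/
abbrev ChevalleyAlgebra : Type (max u v) := K ⊗[ℤ] c.zForm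

/-- The image in the Chevalley algebra of the root vector of the root `β`. -/
noncomputable def rootVecK (β : roots Γ) : c.ChevalleyAlgebra K :=
  (1 : K) ⊗ₜ[ℤ] (⟨c.rootVec β, c.rootVec_mem_zForm β⟩ : c.zForm)

/-- The image `E_x^0` of `E_x` in the Chevalley algebra. -/
noncomputable def E0 (x : V) : c.ChevalleyAlgebra K :=
  (1 : K) ⊗ₜ[ℤ] (⟨kmE Γ x, c.kmE_mem_zForm x⟩ : c.zForm)

/-- The subalgebra `n_+` of the Chevalley algebra generated by the `E_x^0`. -/
noncomputable def nPlus : LieSubalgebra K (c.ChevalleyAlgebra K) :=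
  LieSubalgebra.lieSpan K (c.ChevalleyAlgebra K) (Set.range (c.E0 K))

end ChevalleyBasis

end Chevalley

end Sandwich

namespace Sandwich

universe u v

/-! ### The Cartan form and its vectors of norm two -/

section Pairing

variable {V : Type v} [DecidableEq V] (Γ : SimpleGraph V)

/-! Let ⟨·,·⟩ be the form on `ℤ^V` given by the Cartan matrix. For the diagrams A, D, E it is
positive definite and even. Hence two vectors of norm two pair to a value between -2 and 2, the
extremes occur only for equal or opposite vectors, and their sum has norm two exactly when they pair
to -1. The proof plays an upper bound coming from relations against a lower bound coming from an
explicit model, both indexed by the vectors of norm two.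

Upper bound: in a Lie ring without 2-torsion, take elements `e x` that commute for non-adjacent
vertices and satisfy `[e x, [e x, e y]] = 0` for adjacent ones. Consider iterated brackets of them
all of whose tails have weights of norm two. Such a monomial is determined up to sign by its weight
(`IsRootMonomial.eq_or_eq_neg`). Bracketing it with `e x` gives zero if its weight pairs
nonnegatively with the simple root (`IsRootMonomial.lie_eq_zero`), and another such monomial
otherwise. So these monomials span whatever the `e x` generate. This bounds L(0) by one vector per
positive vector of norm two, and, applied to the `E_x` and to the `F_x`, it bounds the Kac-Moody
algebra (`kacMoody_eq_sup`).

Lower bound: a bilinear sign cocycle turns the space with basis the vertices and the vectors of norm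
two into a Lie algebra satisfying the Serre relations. The map `comparison` from the Kac-Moody
algebra carries the spanning family to a basis up to signs, so it is injective. Therefore the roots
are the vectors of norm two (`roots_eq_normTwo`), and a Chevalley basis can be pulled back.

In an arbitrary Chevalley basis, if β, γ and β + γ are roots then β and γ pair to -1, so γ - β is
not a root, p = 0, and the structure constant is ±1 over every field. Hence the positive root
vectors span n_+. The simple root vectors are sandwiches in n_+: if α_x pairs to -1 with β, it pairs
to 1 with α_x + β, so the second bracket vanishes. The resulting map from L(0) to n_+ sends a
spanning family to a basis and is bijective. Characteristic different from 2 enters only through the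
absence of 2-torsion in L(0). -/

theorem cartanMatrix_self (x : V) : cartanMatrix Γ x x = 2 := by simp [cartanMatrix]

variable {Γ} in
theorem cartanMatrix_of_adj {x y : V} (h : Γ.Adj x y) : cartanMatrix Γ x y = -1 := by
  simp [cartanMatrix, h, h.ne]

variable {Γ} in
theorem cartanMatrix_of_not_adj {x y : V} (hxy : x ≠ y) (h : ¬ Γ.Adj x y) :
    cartanMatrix Γ x y = 0 := by
  simp [cartanMatrix, h, hxy]

theorem cartanMatrix_comm (x y : V) : cartanMatrix Γ x y = cartanMatrix Γ y x := by
  rcases eq_or_ne x y with rfl | h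
  · rfl
  · by_cases hA : Γ.Adj x y
    · rw [cartanMatrix_of_adj hA, cartanMatrix_of_adj hA.symm]
    · rw [cartanMatrix_of_not_adj h hA, cartanMatrix_of_not_adj h.symm fun h' => hA h'.symm]

theorem simpleRoot_nonneg (x : V) : (0 : V → ℤ) ≤ simpleRoot x := by
  simp [simpleRoot]

theorem simpleRoot_injective : Function.Injective (simpleRoot : V → V → ℤ) := fun x y h => by
  by_contra hxy
  have := congrFun h x
  simp [simpleRoot, hxy] at this

variable [Fintype V]

/-- The symmetric bilinear form on `ℤ^V` whose Gram matrix is the Cartan matrix. -/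
noncomputable def pairing (β γ : V → ℤ) : ℤ := ∑ x, ∑ y, β x * cartanMatrix Γ x y * γ y

theorem pairing_add_left (β γ δ : V → ℤ) :
    pairing Γ (β + γ) δ = pairing Γ β δ + pairing Γ γ δ := by
  simp [pairing, add_mul, Finset.sum_add_distrib]

theorem pairing_comm (β γ : V → ℤ) : pairing Γ β γ = pairing Γ γ β := by
  rw [pairing, Finset.sum_comm, pairing]
  refine Finset.sum_congr rfl fun x _ => Finset.sum_congr rfl fun y _ => ?_
  rw [cartanMatrix_comm]; ring

theorem pairing_add_right (β γ δ : V → ℤ) :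
    pairing Γ β (γ + δ) = pairing Γ β γ + pairing Γ β δ := by
  simp only [pairing_comm Γ β, pairing_add_left]

theorem pairing_neg_left (β γ : V → ℤ) : pairing Γ (-β) γ = -pairing Γ β γ := by
  simp [pairing]

theorem pairing_neg_right (β γ : V → ℤ) : pairing Γ β (-γ) = -pairing Γ β γ := by
  simp [pairing]

theorem pairing_sub_left (β γ δ : V → ℤ) :
    pairing Γ (β - γ) δ = pairing Γ β δ - pairing Γ γ δ := by
  rw [sub_eq_add_neg, pairing_add_left, pairing_neg_left, sub_eq_add_neg]

theorem pairing_sub_right (β γ δ : V → ℤ) :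
    pairing Γ β (γ - δ) = pairing Γ β γ - pairing Γ β δ := by
  rw [sub_eq_add_neg, pairing_add_right, pairing_neg_right, sub_eq_add_neg]

theorem pairing_zero_left (β : V → ℤ) : pairing Γ 0 β = 0 := by simp [pairing]

theorem pairing_zero_right (β : V → ℤ) : pairing Γ β 0 = 0 := by simp [pairing]

theorem pairing_simpleRoot_left (x : V) (β : V → ℤ) :
    pairing Γ (simpleRoot x) β = ∑ y, cartanMatrix Γ x y * β y := by
  rw [pairing, Finset.sum_eq_single x]
  · simp [simpleRoot]
  · intro y _ h
    simp [simpleRoot, h]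
  · simp

theorem pairing_simpleRoot_simpleRoot (x y : V) :
    pairing Γ (simpleRoot x) (simpleRoot y) = cartanMatrix Γ x y := by
  rw [pairing_simpleRoot_left, Finset.sum_eq_single y]
  · simp [simpleRoot]
  · intro z _ h
    simp [simpleRoot, h]
  · simp

theorem pairing_eq_sum_simpleRoot (β γ : V → ℤ) :
    pairing Γ β γ = ∑ x, β x * pairing Γ (simpleRoot x) γ := by
  simp only [pairing_simpleRoot_left, Finset.mul_sum]
  simp only [pairing, mul_assoc]

/-- The Cartan form is positive definite. -/
def CartanPosDef : Prop := ∀ β : V → ℤ, β ≠ 0 → 0 < pairing Γ β β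

/-- The vectors of norm two. -/
def normTwo : Set (V → ℤ) := {β | pairing Γ β β = 2}

theorem simpleRoot_mem_normTwo (x : V) : simpleRoot x ∈ normTwo Γ := by
  simp [normTwo, pairing_simpleRoot_simpleRoot, cartanMatrix_self]

variable {Γ}

theorem ne_zero_of_mem_normTwo {β : V → ℤ} (hβ : β ∈ normTwo Γ) : β ≠ 0 := by
  rintro rfl
  simp [normTwo, pairing_zero_left] at hβ

theorem neg_mem_normTwo {β : V → ℤ} (hβ : β ∈ normTwo Γ) : -β ∈ normTwo Γ := by
  simpa [normTwo, pairing_neg_left, pairing_neg_right] using hβ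

theorem pairing_add_self (β γ : V → ℤ) :
    pairing Γ (β + γ) (β + γ) = pairing Γ β β + 2 * pairing Γ β γ + pairing Γ γ γ := by
  rw [pairing_add_left, pairing_add_right, pairing_add_right, pairing_comm Γ γ β]; ring

theorem pairing_sub_self (β γ : V → ℤ) :
    pairing Γ (β - γ) (β - γ) = pairing Γ β β - 2 * pairing Γ β γ + pairing Γ γ γ := by
  rw [pairing_sub_left, pairing_sub_right, pairing_sub_right, pairing_comm Γ γ β]; ring

theorem add_mem_normTwo_iff {β γ : V → ℤ} (hβ : β ∈ normTwo Γ) (hγ : γ ∈ normTwo Γ) :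
    β + γ ∈ normTwo Γ ↔ pairing Γ β γ = -1 := by
  simp only [normTwo, Set.mem_ofPred_eq] at *
  rw [pairing_add_self]; omega

theorem sub_mem_normTwo_iff {β γ : V → ℤ} (hβ : β ∈ normTwo Γ) (hγ : γ ∈ normTwo Γ) :
    β - γ ∈ normTwo Γ ↔ pairing Γ β γ = 1 := by
  simp only [normTwo, Set.mem_ofPred_eq] at *
  rw [pairing_sub_self]; omega

/-! ### Consequences of positive definiteness for vectors of norm two -/

namespace CartanPosDef

theorem nonneg (hp : CartanPosDef Γ) (β : V → ℤ) : 0 ≤ pairing Γ β β := by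
  rcases eq_or_ne β 0 with rfl | h
  · rw [pairing_zero_left]
  · exact (hp β h).le

theorem eq_zero (hp : CartanPosDef Γ) {β : V → ℤ} (h : pairing Γ β β = 0) : β = 0 := by
  by_contra h0
  exact (hp β h0).ne' h

theorem two_le (hp : CartanPosDef Γ) {β : V → ℤ} (h : β ≠ 0) (he : Even (pairing Γ β β)) :
    2 ≤ pairing Γ β β := by
  have := hp β h
  obtain ⟨k, hk⟩ := he
  omega

theorem pairing_le_two (hp : CartanPosDef Γ) {β γ : V → ℤ} (hβ : β ∈ normTwo Γ)
    (hγ : γ ∈ normTwo Γ) : pairing Γ β γ ≤ 2 := by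
  have h := hp.nonneg (β - γ)
  simp only [normTwo, Set.mem_ofPred_eq] at *
  rw [pairing_sub_self] at h
  omega

theorem neg_two_le_pairing (hp : CartanPosDef Γ) {β γ : V → ℤ} (hβ : β ∈ normTwo Γ)
    (hγ : γ ∈ normTwo Γ) : -2 ≤ pairing Γ β γ := by
  have h := hp.pairing_le_two hβ (neg_mem_normTwo hγ)
  rw [pairing_neg_right] at h
  omega

theorem eq_of_pairing_eq_two (hp : CartanPosDef Γ) {β γ : V → ℤ} (hβ : β ∈ normTwo Γ)
    (hγ : γ ∈ normTwo Γ) (h : pairing Γ β γ = 2) : β = γ := by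
  refine sub_eq_zero.1 (hp.eq_zero ?_)
  simp only [normTwo, Set.mem_ofPred_eq] at *
  rw [pairing_sub_self]
  omega

theorem eq_neg_of_pairing_eq_neg_two (hp : CartanPosDef Γ) {β γ : V → ℤ} (hβ : β ∈ normTwo Γ)
    (hγ : γ ∈ normTwo Γ) (h : pairing Γ β γ = -2) : β = -γ :=
  hp.eq_of_pairing_eq_two hβ (neg_mem_normTwo hγ) (by rw [pairing_neg_right, h]; rfl)

end CartanPosDef

/-- Only off-diagonal entries of the Cartan matrix contribute, and these are 0 or -1. -/
theorem pairing_nonpos_of_disjoint {β γ : V → ℤ} (hβ : 0 ≤ β) (hγ : 0 ≤ γ)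
    (h : ∀ x, β x = 0 ∨ γ x = 0) : pairing Γ β γ ≤ 0 := by
  refine Finset.sum_nonpos fun x _ => Finset.sum_nonpos fun y _ => ?_
  rcases eq_or_ne x y with rfl | hxy
  · rcases h x with h | h <;> simp [h]
  · have hA : cartanMatrix Γ x y ≤ 0 := by
      rw [cartanMatrix, if_neg hxy]; split_ifs <;> simp
    exact mul_nonpos_of_nonpos_of_nonneg (mul_nonpos_of_nonneg_of_nonpos (hβ x) hA) (hγ y)

/-- The Cartan form is even. -/
theorem even_pairing_self (β : V → ℤ) : Even (pairing Γ β β) := by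
  classical
  suffices h : ∀ s : Finset V, ∀ β : V → ℤ, (∀ x ∉ s, β x = 0) → Even (pairing Γ β β) from
    h Finset.univ β (by simp)
  intro s
  induction s using Finset.induction_on with
  | empty =>
    intro β h
    have : β = 0 := funext fun x => h x (by simp)
    simp [this, pairing_zero_left]
  | insert a s _ ih =>
    intro β h
    -- Clearing the coordinate at `a` changes the norm by -2 β_a ⟨α_a, β⟩ + 2 β_a², which is even.
    have h1 := ih (β - β a • simpleRoot a) fun x hx => by
      rcases eq_or_ne x a with rfl | hxa
      · simp [simpleRoot]
      · simp [simpleRoot, hxa, h x (by simp [hx, hxa])]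
    have h2 : ∀ γ : V → ℤ, pairing Γ (β a • simpleRoot a) γ
        = β a * pairing Γ (simpleRoot a) γ := fun γ => by
      simp [pairing, Finset.mul_sum, mul_assoc]
    rw [pairing_sub_self, pairing_comm Γ β (_ • _), h2, h2, pairing_comm Γ (simpleRoot a) (_ • _), h2,
      pairing_simpleRoot_simpleRoot, cartanMatrix_self] at h1
    obtain ⟨k, hk⟩ := h1
    exact ⟨k + β a * pairing Γ (simpleRoot a) β - β a * β a, by linarith⟩

/-- If the positive and negative parts were both nonzero, each would have norm at least 2 by
evenness. As they pair nonpositively, their difference would have norm at least 4. -/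
theorem CartanPosDef.nonneg_or_nonpos (hp : CartanPosDef Γ) {β : V → ℤ} (hβ : β ∈ normTwo Γ) :
    0 ≤ β ∨ 0 ≤ -β := by
  have h0 : pairing Γ β⁺ β⁻ ≤ 0 := by
    refine pairing_nonpos_of_disjoint (posPart_nonneg β) (negPart_nonneg β) fun x => ?_
    simp only [Pi.posPart_apply, Pi.negPart_apply, posPart_eq_zero,
      negPart_eq_zero]
    exact le_total _ _
  by_contra! h
  have h1 : β⁺ ≠ 0 := fun hh => h.2 (neg_nonneg.2 (posPart_eq_zero.1 hh))
  have h2 : β⁻ ≠ 0 := fun hh => h.1 (negPart_eq_zero.1 hh)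
  have h3 := hp.two_le h1 (even_pairing_self _)
  have h4 := hp.two_le h2 (even_pairing_self _)
  have h5 : pairing Γ β β = 2 := hβ
  rw [← posPart_sub_negPart β, pairing_sub_self] at h5
  omega

/-- The norm is ∑ β_x ⟨α_x, β⟩ with β_x ≥ 0, so some factor ⟨α_x, β⟩ must be positive. -/
theorem exists_one_le_pairing_simpleRoot {β : V → ℤ} (hβ : β ∈ normTwo Γ) (h0 : 0 ≤ β) :
    ∃ x, 1 ≤ pairing Γ (simpleRoot x) β := by
  by_contra! h
  have h1 : pairing Γ β β ≤ 0 := by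
    rw [pairing_eq_sum_simpleRoot]
    exact Finset.sum_nonpos fun x _ =>
      mul_nonpos_of_nonneg_of_nonpos (h0 x) (by have := h x; omega)
  have h2 : pairing Γ β β = 2 := hβ
  omega

/-- If the coordinate of β at `x` were 0, then β and α_x would have disjoint supports and pair
nonpositively. -/
theorem nonneg_sub_simpleRoot {β : V → ℤ} (h0 : 0 ≤ β) {x : V}
    (h : 1 ≤ pairing Γ (simpleRoot x) β) : 0 ≤ β - simpleRoot x := by
  have hx : 1 ≤ β x := by
    by_contra! hx
    have h1 : pairing Γ (simpleRoot x) β ≤ 0 := by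
      rw [pairing_comm]
      have hx0 : β x = 0 := le_antisymm (by omega) (h0 x)
      refine pairing_nonpos_of_disjoint h0 (simpleRoot_nonneg x) fun y => ?_
      rcases eq_or_ne y x with rfl | hy
      · exact Or.inl hx0
      · exact Or.inr (by simp [simpleRoot, hy])
    omega
  intro y
  rcases eq_or_ne y x with rfl | hy
  · simpa [simpleRoot] using hx
  · simpa [simpleRoot, hy] using h0 y

theorem CartanPosDef.eq_of_forall_pairing (hp : CartanPosDef Γ) {β γ : V → ℤ}
    (h : ∀ x, pairing Γ (simpleRoot x) β = pairing Γ (simpleRoot x) γ) : β = γ := by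
  refine sub_eq_zero.1 (hp.eq_zero ?_)
  rw [pairing_eq_sum_simpleRoot]
  exact Finset.sum_eq_zero fun x _ => by rw [pairing_sub_right, h, sub_self, mul_zero]

/-- A positive vector that the Cartan matrix maps to a positive vector shows that the Cartan
form is positive definite. -/
theorem cartanPosDef_of_pos_vector (w : V → ℤ) (hw : ∀ x, 0 < w x)
    (hA : ∀ x, 0 < ∑ y, cartanMatrix Γ x y * w y) : CartanPosDef Γ := by
  intro β hβ
  -- In the coordinates t = β / w the form dominates the diagonal form ∑ w_x (Aw)_x t_x², because 2
  -- t_x t_y ≤ t_x² + t_y² and the off-diagonal entries of A are nonpositive.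
  set t : V → ℚ := fun x => β x / w x with ht
  have hwq : ∀ x, (0 : ℚ) < w x := fun x => by exact_mod_cast hw x
  have hβt : ∀ x, (β x : ℚ) = w x * t x := fun x => by
    rw [ht]; field_simp [(hwq x).ne']
  have hAq : ∀ x, (0 : ℚ) < ∑ y, (cartanMatrix Γ x y : ℚ) * w y := fun x => by
    exact_mod_cast hA x
  have h1 : ∑ x, w x * t x ^ 2 * ∑ y, (cartanMatrix Γ x y : ℚ) * w y ≤ (pairing Γ β β : ℚ) := by
    have e1 : (pairing Γ β β : ℚ)
        = ∑ x, ∑ y, (w x * t x) * (cartanMatrix Γ x y : ℚ) * (w y * t y) := by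
      simp only [pairing, Int.cast_sum, Int.cast_mul, hβt]
    have e2 : ∑ x, w x * t x ^ 2 * ∑ y, (cartanMatrix Γ x y : ℚ) * w y
        = ∑ x, ∑ y, w x * t x ^ 2 * ((cartanMatrix Γ x y : ℚ) * w y) := by
      simp only [Finset.mul_sum]
    have e3 : ∑ x, w x * t x ^ 2 * ∑ y, (cartanMatrix Γ x y : ℚ) * w y
        = ∑ x, ∑ y, w y * t y ^ 2 * ((cartanMatrix Γ x y : ℚ) * w x) := by
      rw [e2, Finset.sum_comm]
      refine Finset.sum_congr rfl fun x _ => Finset.sum_congr rfl fun y _ => ?_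
      rw [cartanMatrix_comm]
    have e4 : ∑ x, ∑ y, (w x * t x ^ 2 * ((cartanMatrix Γ x y : ℚ) * w y)
        + w y * t y ^ 2 * ((cartanMatrix Γ x y : ℚ) * w x))
        ≤ ∑ x, ∑ y, 2 * ((w x * t x) * (cartanMatrix Γ x y : ℚ) * (w y * t y)) := by
      refine Finset.sum_le_sum fun x _ => Finset.sum_le_sum fun y _ => ?_
      rcases eq_or_ne x y with rfl | hxy
      · exact le_of_eq (by ring)
      · have hA : (cartanMatrix Γ x y : ℚ) ≤ 0 := by
          have : cartanMatrix Γ x y ≤ 0 := by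
            rw [cartanMatrix, if_neg hxy]; split_ifs <;> simp
          exact_mod_cast this
        have : 0 ≤ (w x * w y * (t x - t y) ^ 2) * (-(cartanMatrix Γ x y : ℚ)) :=
          mul_nonneg (mul_nonneg (mul_nonneg (hwq x).le (hwq y).le) (sq_nonneg _)) (by linarith)
        linarith
    simp only [Finset.sum_add_distrib, ← Finset.mul_sum] at e4 e2 e3 ⊢
    linarith
  have h2 : 0 < ∑ x, w x * t x ^ 2 * ∑ y, (cartanMatrix Γ x y : ℚ) * w y := by
    obtain ⟨a, ha⟩ := Function.ne_iff.1 hβ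
    refine Finset.sum_pos' (fun x _ => ?_) ⟨a, Finset.mem_univ a, ?_⟩
    · exact mul_nonneg (mul_nonneg (hwq x).le (sq_nonneg _)) (hAq x).le
    · have : t a ≠ 0 := by
        rw [ht]
        exact div_ne_zero (by exact_mod_cast ha) (hwq a).ne'
      exact mul_pos (mul_pos (hwq a) (by positivity)) (hAq a)
  exact_mod_cast h2.trans_le h1

end Pairing

theorem lie_lie_comm {L : Type*} [LieRing L] {a b : L} (h : ⁅a, b⁆ = 0) (m : L) :
    ⁅a, ⁅b, m⁆⁆ = ⁅b, ⁅a, m⁆⁆ := by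
  rw [leibniz_lie, h, zero_lie, zero_add]

/-! ### Monomials along positive roots in a Lie ring with Serre relations -/

section RootMonomials

variable {V : Type v} [Fintype V] [DecidableEq V] (Γ : SimpleGraph V)

/-- `IsRootMonomial Γ e n β m`: `m` is the iterated bracket `[e x₁, [e x₂, …, e xₙ]]`, of weight
`β`, all of whose tails have weights of norm two. -/
inductive IsRootMonomial {L : Type*} [LieRing L] (e : V → L) : ℕ → (V → ℤ) → L → Prop
  | gen (x : V) : IsRootMonomial e 1 (simpleRoot x) (e x)
  | lie (x : V) {n : ℕ} {β : V → ℤ} {m : L} : IsRootMonomial e n β m →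
      pairing Γ (simpleRoot x) β = -1 → IsRootMonomial e (n + 1) (simpleRoot x + β) ⁅e x, m⁆

variable {Γ} {L : Type*} [LieRing L] {e : V → L}

namespace IsRootMonomial

theorem cast {n n' : ℕ} {β β' : V → ℤ} {m m' : L} (h : IsRootMonomial Γ e n β m) (hn : n = n')
    (hβ : β = β') (hm : m = m') : IsRootMonomial Γ e n' β' m' := by
  subst hn hβ hm; exact h

theorem mem_normTwo {n : ℕ} {β : V → ℤ} {m : L} (h : IsRootMonomial Γ e n β m) :
    β ∈ normTwo Γ := by
  induction h with
  | gen x => exact simpleRoot_mem_normTwo Γ x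
  | lie x _ hx ih => exact (add_mem_normTwo_iff (simpleRoot_mem_normTwo Γ x) ih).2 hx

theorem nonneg {n : ℕ} {β : V → ℤ} {m : L} (h : IsRootMonomial Γ e n β m) : 0 ≤ β := by
  induction h with
  | gen x => exact simpleRoot_nonneg x
  | lie x _ _ ih => exact add_nonneg (simpleRoot_nonneg x) ih

theorem sum_eq {n : ℕ} {β : V → ℤ} {m : L} (h : IsRootMonomial Γ e n β m) :
    ∑ x, β x = n := by
  induction h with
  | gen x => simp [simpleRoot]
  | lie x _ _ ih => simp [Finset.sum_add_distrib, ih, simpleRoot, add_comm]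

theorem map {L' : Type*} [LieRing L'] {e' : V → L'} (f : L → L') (hf : ∀ a b, f ⁅a, b⁆ = ⁅f a, f b⁆)
    (he : ∀ x, f (e x) = e' x) {n : ℕ} {β : V → ℤ} {m : L} (h : IsRootMonomial Γ e n β m) :
    IsRootMonomial Γ e' n β (f m) := by
  induction h with
  | gen x => rw [he]; exact .gen x
  | lie x _ hx ih => rw [hf, he]; exact .lie x ih hx

/-- A longer monomial has weight α_y + γ with ⟨α_y, γ⟩ = -1, which pairs to 1 with α_y. No entry of
the Cartan matrix is 1, so this weight is not simple. -/
theorem eq_gen {n : ℕ} {x : V} {m : L}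
    (h : IsRootMonomial Γ e n (simpleRoot x) m) : m = e x := by
  generalize hβ : simpleRoot x = β at h
  cases h with
  | gen y => rw [simpleRoot_injective hβ]
  | lie y h hy =>
    exfalso
    rename_i k γ m
    have h1 : pairing Γ (simpleRoot y) (simpleRoot x) = 1 := by
      rw [hβ, pairing_add_right, hy, pairing_simpleRoot_simpleRoot, cartanMatrix_self]; rfl
    rw [pairing_simpleRoot_simpleRoot, cartanMatrix] at h1
    split_ifs at h1 <;> simp at h1

/-- Induction on the height: some simple root pairs to 1 or 2 with β. The value 2 means that β is
that simple root; the value 1 means that subtracting it leaves a positive vector of norm two. -/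
theorem exists_of_nonneg (e : V → L) {β : V → ℤ} (hβ : β ∈ normTwo Γ) (h0 : 0 ≤ β)
    (hp : CartanPosDef Γ) : ∃ n m, IsRootMonomial Γ e n β m := by
  obtain ⟨k, hk⟩ : ∃ k : ℕ, ∑ x, β x = k :=
    ⟨_, (Int.toNat_of_nonneg (Finset.sum_nonneg fun x _ => h0 x)).symm⟩
  induction k generalizing β with
  | zero =>
    exfalso
    refine ne_zero_of_mem_normTwo hβ (funext fun x => ?_)
    exact (Finset.sum_eq_zero_iff_of_nonneg fun x _ => h0 x).1 (by simpa using hk) x (by simp)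
  | succ k ih =>
    obtain ⟨x, hx⟩ := exists_one_le_pairing_simpleRoot hβ h0
    have hle := hp.pairing_le_two (simpleRoot_mem_normTwo Γ x) hβ
    rcases eq_or_ne (pairing Γ (simpleRoot x) β) 2 with h2 | h2
    · obtain rfl := hp.eq_of_pairing_eq_two (simpleRoot_mem_normTwo Γ x) hβ h2
      exact ⟨1, _, .gen x⟩
    · have h1 : pairing Γ (simpleRoot x) β = 1 := by omega
      obtain ⟨n, m, hm⟩ := ih ((sub_mem_normTwo_iff hβ (simpleRoot_mem_normTwo Γ x)).2
        (by rw [pairing_comm, h1])) (nonneg_sub_simpleRoot h0 hx)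
        (by simp [Finset.sum_sub_distrib, hk, simpleRoot])
      refine ⟨n + 1, _, (hm.lie x ?_).cast rfl (by abel) rfl⟩
      rw [pairing_sub_right, h1, pairing_simpleRoot_simpleRoot, cartanMatrix_self]; rfl

/-! ### Uniqueness up to sign and vanishing of brackets -/

section Commuting

variable (hcomm : ∀ x y, ¬ Γ.Adj x y → ⁅e x, e y⁆ = 0)

include hcomm

/-- The letter `e x` can be moved to the front. It commutes past non-adjacent letters, and when it
meets an adjacent one the remaining tail is forced to be `e x` itself, so antisymmetry suffices. -/
theorem exists_eq_lie (hp : CartanPosDef Γ) {n : ℕ} {β : V → ℤ} {m : L}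
    (h : IsRootMonomial Γ e n β m) {x : V} (hx : pairing Γ (simpleRoot x) β = 1) :
    ∃ k m', n = k + 1 ∧ IsRootMonomial Γ e k (β - simpleRoot x) m' ∧
      (m = ⁅e x, m'⁆ ∨ m = -⁅e x, m'⁆) := by
  induction h with
  | gen y =>
    rw [pairing_simpleRoot_simpleRoot, cartanMatrix] at hx
    split_ifs at hx <;> simp at hx
  | @lie y n β m h hy ih =>
    rcases eq_or_ne x y with rfl | hxy
    · exact ⟨n, m, rfl, h.cast rfl (by abel) rfl, Or.inl rfl⟩
    rw [pairing_add_right, pairing_simpleRoot_simpleRoot] at hx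
    by_cases hA : Γ.Adj x y
    · rw [cartanMatrix_of_adj hA] at hx
      -- The adjacent letter contributes -1 to a pairing of 1, so the tail pairs to 2 with α_x and
      -- has weight α_x.
      obtain rfl := hp.eq_of_pairing_eq_two (simpleRoot_mem_normTwo Γ x) h.mem_normTwo (by omega)
      obtain rfl := h.eq_gen
      have hn : n = 1 := by exact_mod_cast h.sum_eq.symm.trans (gen (Γ := Γ) (e := e) x).sum_eq
      exact ⟨1, e y, by rw [hn], (IsRootMonomial.gen y).cast rfl (by abel) rfl,
        Or.inr (lie_skew _ _).symm⟩
    · rw [cartanMatrix_of_not_adj hxy hA, zero_add] at hx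
      obtain ⟨k, m', rfl, hm', hm⟩ := ih hx
      have hy' : pairing Γ (simpleRoot y) (β - simpleRoot x) = -1 := by
        rw [pairing_sub_right, hy, pairing_simpleRoot_simpleRoot,
          cartanMatrix_of_not_adj hxy.symm fun h' => hA h'.symm, sub_zero]
      refine ⟨k + 1, _, rfl, (hm'.lie y hy').cast rfl (by abel) rfl, ?_⟩
      rw [lie_lie_comm (hcomm x y hA)]
      rcases hm with rfl | rfl
      · exact Or.inl rfl
      · exact Or.inr (lie_neg _ _)

/-- A root monomial is determined up to sign by its weight. -/
theorem eq_or_eq_neg (hp : CartanPosDef Γ) {n k : ℕ} {β : V → ℤ} {m m' : L}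
    (h : IsRootMonomial Γ e n β m) (h' : IsRootMonomial Γ e k β m') : m' = m ∨ m' = -m := by
  induction h generalizing k m' with
  | gen x => exact Or.inl (h'.eq_gen)
  | @lie x n β m h hx ih =>
    -- The common weight pairs to 1 with the simple root of the first letter `x`, so the second
    -- monomial can also be made to start with `e x`; then the tails are compared.
    obtain ⟨l, m₁, -, hm₁, h₁⟩ := exists_eq_lie hcomm hp h' (x := x)
      (by rw [pairing_add_right, hx, pairing_simpleRoot_simpleRoot, cartanMatrix_self]; rfl)
    rcases ih (hm₁.cast rfl (by abel) rfl) with rfl | rfl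
    · exact h₁
    · rw [lie_neg, neg_neg] at h₁
      exact h₁.symm

/-- The vanishing of `[e x, m]` when the weight of `m` pairs nonnegatively with the simple
root of `x`. -/
theorem lie_eq_zero (hp : CartanPosDef Γ)
    (hserre : ∀ x y, Γ.Adj x y → ⁅e x, ⁅e x, e y⁆⁆ = 0) (htors : ∀ z : L, z + z = 0 → z = 0)
    {n : ℕ} {β : V → ℤ} {m : L} (h : IsRootMonomial Γ e n β m) {x : V}
    (hx : 0 ≤ pairing Γ (simpleRoot x) β) : ⁅e x, m⁆ = 0 := by
  induction n using Nat.strong_induction_on generalizing β m x with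
  | _ n ih =>
  have hle := hp.pairing_le_two (simpleRoot_mem_normTwo Γ x) h.mem_normTwo
  obtain h2 | h1 | h0 : pairing Γ (simpleRoot x) β = 2 ∨ pairing Γ (simpleRoot x) β = 1 ∨
    pairing Γ (simpleRoot x) β = 0 := by omega
  · obtain rfl := hp.eq_of_pairing_eq_two (simpleRoot_mem_normTwo Γ x) h.mem_normTwo h2
    rw [h.eq_gen, lie_self]
  -- Here m = ±[e x, m₁], so the square of ad(e x) has to kill m₁; the first letter `y` of m₁
  -- decides how.
  · obtain ⟨k, m₁, rfl, hm₁, hm⟩ := exists_eq_lie hcomm hp h h1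
    suffices hs : ⁅e x, ⁅e x, m₁⁆⁆ = 0 by
      rcases hm with rfl | rfl
      · exact hs
      · rw [lie_neg, hs, neg_zero]
    have hδ : pairing Γ (simpleRoot x) (β - simpleRoot x) = -1 := by
      rw [pairing_sub_right, h1, pairing_simpleRoot_simpleRoot, cartanMatrix_self]; rfl
    clear hm h
    generalize β - simpleRoot x = δ at hm₁ hδ
    cases hm₁ with
    | gen y =>
      refine hserre x y ?_
      by_contra hA
      rw [pairing_simpleRoot_simpleRoot, cartanMatrix] at hδ
      split_ifs at hδ
    | @lie y l ε m₂ hm₂ hy =>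
      rw [pairing_add_right, pairing_simpleRoot_simpleRoot] at hδ
      rcases eq_or_ne x y with rfl | hxy
      · rw [hy, cartanMatrix_self] at hδ
        omega
      by_cases hA : Γ.Adj x y
      · rw [cartanMatrix_of_adj hA] at hδ
        -- The weight of m₂ is orthogonal to α_x, so m₂ commutes with `e x` and only [[e x, [e x, e
        -- y]], m₂] survives, which the Serre relation kills.
        have hz : ⁅e x, m₂⁆ = 0 := ih l (by omega) hm₂ (by omega)
        rw [leibniz_lie (e x) (e y), hz, lie_zero, add_zero, leibniz_lie, hserre x y hA, zero_lie,
          zero_add, hz, lie_zero]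
      -- Both copies of `e x` pass `e y`, leaving a bracket of `e x` with the shorter monomial [e x,
      -- m₂], whose weight pairs to 2 - 1 = 1 with α_x.
      · rw [cartanMatrix_of_not_adj hxy hA, zero_add] at hδ
        rw [lie_lie_comm (hcomm x y hA), lie_lie_comm (hcomm x y hA),
          ih (l + 1) (by omega) (hm₂.lie x hδ) (by
            rw [pairing_add_right, pairing_simpleRoot_simpleRoot, cartanMatrix_self]; omega),
          lie_zero]
  · cases h with
    | gen y =>
      refine hcomm x y fun hA => ?_
      rw [pairing_simpleRoot_simpleRoot, cartanMatrix_of_adj hA] at h0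
      omega
    | @lie y l δ m₁ hm₁ hy =>
      rw [pairing_add_right, pairing_simpleRoot_simpleRoot] at h0
      rcases eq_or_ne x y with rfl | hxy
      · rw [hy, cartanMatrix_self] at h0
        omega
      by_cases hA : Γ.Adj x y
      · rw [cartanMatrix_of_adj hA] at h0
        have hδ : pairing Γ (simpleRoot x) δ = 1 := by omega
        obtain ⟨k, m₂, rfl, hm₂, hm⟩ := exists_eq_lie hcomm hp hm₁ hδ
        have hε : pairing Γ (simpleRoot y) (δ - simpleRoot x) = 0 := by
          rw [pairing_sub_right, hy, pairing_simpleRoot_simpleRoot, cartanMatrix_of_adj hA.symm]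
          rfl
        have hx₁ : ⁅e x, m₁⁆ = 0 := ih (k + 1) (by omega) hm₁ (by omega)
        have hx₂ : ⁅e x, ⁅e x, m₂⁆⁆ = 0 := by
          rcases hm with rfl | rfl
          · exact hx₁
          · rwa [lie_neg, neg_eq_zero] at hx₁
        have hy₂ : ⁅e y, m₂⁆ = 0 := ih k (by omega) hm₂ hε.ge
        -- Since [e y, m₂] = 0, expanding [e x, [e x, [e y, m₂]]] by Leibniz gives twice this
        -- bracket. This is the only use of the absence of 2-torsion.
        have hz : ⁅⁅e x, e y⁆, ⁅e x, m₂⁆⁆ = 0 := by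
          apply htors
          have h3 : ⁅e x, ⁅e x, ⁅e y, m₂⁆⁆⁆ = 0 := by rw [hy₂, lie_zero, lie_zero]
          rw [leibniz_lie (e x) (e y) m₂, lie_add, leibniz_lie (e x) ⁅e x, e y⁆ m₂, hserre x y hA,
            zero_lie, zero_add, leibniz_lie (e x) (e y), hx₂, lie_zero, add_zero] at h3
          exact h3
        have hs : ⁅e x, ⁅e y, ⁅e x, m₂⁆⁆⁆ = 0 := by
          rw [leibniz_lie, hz, hx₂, lie_zero, add_zero]
        rcases hm with rfl | rfl
        · exact hs
        · rw [lie_neg, lie_neg, hs, neg_zero]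
      · rw [cartanMatrix_of_not_adj hxy hA, zero_add] at h0
        rw [lie_lie_comm (hcomm x y hA), ih l (by omega) hm₁ h0.ge, lie_zero]

end Commuting

end IsRootMonomial

/-- The span of all root monomials. -/
def rootMonomialSpan (Γ : SimpleGraph V) (K : Type*) [CommRing K] {L : Type*} [LieRing L]
    [LieAlgebra K L] (e : V → L) : Submodule K L :=
  Submodule.span K {m | ∃ n β, IsRootMonomial Γ e n β m}

theorem gen_mem_rootMonomialSpan (K : Type*) [CommRing K] [LieAlgebra K L] (x : V) :
    e x ∈ rootMonomialSpan Γ K e :=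
  Submodule.subset_span ⟨1, _, .gen x⟩

/-- Three cases for the pairing of α_x with the weight: nonnegative gives zero, -1 gives a longer
root monomial, and -2 would make the weight -α_x, contrary to its positivity. -/
theorem lie_mem_rootMonomialSpan (hp : CartanPosDef Γ) (K : Type*) [CommRing K] [LieAlgebra K L]
    (hcomm : ∀ x y, ¬ Γ.Adj x y → ⁅e x, e y⁆ = 0)
    (hserre : ∀ x y, Γ.Adj x y → ⁅e x, ⁅e x, e y⁆⁆ = 0) (htors : ∀ z : L, z + z = 0 → z = 0)
    (x : V) {z : L} (hz : z ∈ rootMonomialSpan Γ K e) : ⁅e x, z⁆ ∈ rootMonomialSpan Γ K e := by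
  induction hz using Submodule.span_induction with
  | zero => simp
  | add a b _ _ ha hb => rw [lie_add]; exact add_mem ha hb
  | smul c a _ ha => rw [lie_smul]; exact Submodule.smul_mem _ c ha
  | mem m hm =>
    obtain ⟨n, β, hm⟩ := hm
    by_cases h0 : 0 ≤ pairing Γ (simpleRoot x) β
    · rw [hm.lie_eq_zero hcomm hp hserre htors h0]
      exact zero_mem _
    have h2 := hp.neg_two_le_pairing (simpleRoot_mem_normTwo Γ x) hm.mem_normTwo
    have h2' : pairing Γ (simpleRoot x) β ≠ -2 := fun h => by
      have h3 := hp.eq_neg_of_pairing_eq_neg_two (simpleRoot_mem_normTwo Γ x) hm.mem_normTwo h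
      have h4 := congrFun h3 x
      have h5 := hm.nonneg x
      simp only [simpleRoot, Pi.single_eq_same, Pi.neg_apply, Pi.zero_apply] at h4 h5
      omega
    exact Submodule.subset_span ⟨n + 1, _, hm.lie x (by omega)⟩

end RootMonomials

/-! ### Subspaces of a finitely generated Lie algebra that are stable under the generators -/

/-- The elements of the free Lie algebra whose images lie in S and map S into itself form a
subalgebra, by the Jacobi identity. It contains the generators, hence everything; S need not be
known to be a subalgebra. -/
theorem eq_top_of_stable {K : Type*} [CommRing K] {X : Type*} {L : Type*} [LieRing L]
    [LieAlgebra K L] (f : FreeLieAlgebra K X →ₗ⁅K⁆ L) (hf : Function.Surjective f)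
    (S : Submodule K L) (h1 : ∀ x, f (FreeLieAlgebra.of K x) ∈ S)
    (h2 : ∀ x, ∀ s ∈ S, ⁅f (FreeLieAlgebra.of K x), s⁆ ∈ S) : S = ⊤ := by
  let U : LieSubalgebra K (FreeLieAlgebra K X) :=
    { carrier := {z | f z ∈ S ∧ ∀ s ∈ S, ⁅f z, s⁆ ∈ S}
      zero_mem' := by simp
      add_mem' := fun {a b} ha hb => ⟨by rw [map_add]; exact add_mem ha.1 hb.1, fun s hs => by
        rw [map_add, add_lie]; exact add_mem (ha.2 s hs) (hb.2 s hs)⟩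
      smul_mem' := fun c a ha => ⟨by rw [map_smul]; exact S.smul_mem c ha.1, fun s hs => by
        rw [map_smul, smul_lie]; exact S.smul_mem c (ha.2 s hs)⟩
      lie_mem' := fun {a b} ha hb => ⟨by rw [LieHom.map_lie]; exact ha.2 _ hb.1, fun s hs => by
        rw [LieHom.map_lie, lie_lie]
        exact sub_mem (ha.2 _ (hb.2 s hs)) (hb.2 _ (ha.2 s hs))⟩ }
  let g : FreeLieAlgebra K X →ₗ⁅K⁆ U :=
    FreeLieAlgebra.lift K fun x => ⟨FreeLieAlgebra.of K x, h1 x, h2 x⟩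
  have hg : U.incl.comp g = LieHom.id := FreeLieAlgebra.hom_ext fun x => by simp [g]
  refine eq_top_iff.2 fun z _ => ?_
  obtain ⟨w, rfl⟩ := hf z
  have hw : w ∈ U := by
    have := LieHom.congr_fun hg w
    rw [LieHom.coe_id, id] at this
    rw [← this]
    exact (g w).2
  exact hw.1

/-! ### Positive definiteness for the Dynkin diagrams of finite type -/

section Dynkin

variable {V : Type v} [Fintype V] [DecidableEq V] {Γ : SimpleGraph V}

theorem cartanPosDef_of_neighbor_sum (w : V → ℤ) (hw : ∀ x, 0 < w x)
    (hA : ∀ x, ∑ y, (open scoped Classical in if Γ.Adj x y then w y else 0) < 2 * w x) :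
    CartanPosDef Γ := by
  classical
  refine cartanPosDef_of_pos_vector w hw fun x => ?_
  have h : ∑ y, cartanMatrix Γ x y * w y = 2 * w x - ∑ y, if Γ.Adj x y then w y else 0 := by
    rw [eq_sub_iff_add_eq, ← Finset.sum_add_distrib, Finset.sum_eq_single x]
    · simp [cartanMatrix_self]
    · intro y _ hy
      by_cases hA : Γ.Adj x y
      · simp [cartanMatrix_of_adj hA, hA]
      · simp [cartanMatrix_of_not_adj hy.symm hA, hA]
    · simp
  rw [h]
  have := hA x
  have e : (∑ y, if Γ.Adj x y then w y else 0) =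
    ∑ y, (open scoped Classical in if Γ.Adj x y then w y else 0) :=
    Finset.sum_congr rfl fun y _ => by congr
  omega

theorem CartanPosDef.of_iso {W : Type*} [Fintype W] [DecidableEq W] {Δ : SimpleGraph W}
    (f : Γ ≃g Δ) (h : CartanPosDef Δ) : CartanPosDef Γ := by
  intro β hβ
  have h1 := h (β ∘ f.symm) fun h0 => hβ (funext fun x => by
    simpa using congrFun h0 (f x))
  have h2 : pairing Δ (β ∘ f.symm) (β ∘ f.symm) = pairing Γ β β := by
    simp only [pairing]
    rw [← f.toEquiv.sum_comp]
    refine Finset.sum_congr rfl fun x _ => ?_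
    rw [← f.toEquiv.sum_comp]
    refine Finset.sum_congr rfl fun y _ => ?_
    have : cartanMatrix Δ (f x) (f y) = cartanMatrix Γ x y := by
      rcases eq_or_ne x y with rfl | hxy
      · simp [cartanMatrix_self]
      · by_cases hA : Γ.Adj x y
        · rw [cartanMatrix_of_adj hA, cartanMatrix_of_adj (f.map_adj_iff.2 hA)]
        · rw [cartanMatrix_of_not_adj hxy hA, cartanMatrix_of_not_adj (f.injective.ne hxy)
            (f.map_adj_iff.not.2 hA)]
    simp [this]
  rwa [h2] at h1

theorem sum_ite_val_eq_le (n k : ℕ) (u : ℕ → ℤ) (hu : 0 ≤ u k) :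
    (∑ y : Fin n, if (y : ℕ) = k then u y else 0) ≤ u k := by
  by_cases hk : k < n
  · rw [Finset.sum_eq_single ⟨k, hk⟩]
    · simp
    · intro y _ hy
      exact if_neg fun h => hy (Fin.ext h)
    · simp
  · rw [Finset.sum_eq_zero]
    · exact hu
    · intro y _
      exact if_neg fun h => hk (by omega)

/-- The sum of a nonnegative function over a set of vertices that is covered by a list of indices
is at most the sum of its values at these indices. -/
theorem sum_ite_le_sum_list (n : ℕ) (u : ℕ → ℤ) (hu : ∀ i, 0 ≤ u i) (p : Fin n → Prop)
    [DecidablePred p] (l : List ℕ) (hl : ∀ y, p y → (y : ℕ) ∈ l) :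
    (∑ y : Fin n, if p y then u y else 0) ≤ (l.map u).sum := by
  induction l generalizing p with
  | nil =>
    rw [Finset.sum_eq_zero]
    · simp
    · intro y _
      exact if_neg fun h => by simpa using hl y h
  | cons k l ih =>
    rw [List.map_cons, List.sum_cons]
    -- The index `k` is split off and removed from the predicate; repetitions and indices beyond `n`
    -- in the list do no harm because `u` is nonnegative.
    have h := ih (fun y => p y ∧ (y : ℕ) ≠ k) fun y hy => by simpa [hy.2] using hl y hy.1
    refine le_trans ?_ (add_le_add (sum_ite_val_eq_le n k u (hu k)) h)
    rw [← Finset.sum_add_distrib]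
    refine Finset.sum_le_sum fun y _ => ?_
    have := hu y
    by_cases h1 : p y <;> by_cases h2 : (y : ℕ) = k <;> simp [h1, h2]
    rwa [← h2]

theorem cartanPosDef_pathGraph (n : ℕ) : CartanPosDef (SimpleGraph.pathGraph n) := by
  classical
  -- These are the coefficients of the sum of the positive roots of A_n, on which the Cartan matrix
  -- takes the constant value 2. The value 0 beyond the path stands in for the missing neighbour of
  -- the last vertex.
  set u : ℕ → ℤ := fun i => if i < n then (i + 1) * (n - i) else 0 with hu
  have hu0 : ∀ i, 0 ≤ u i := fun i => by
    simp only [hu]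
    split_ifs with h
    · have : (0 : ℤ) ≤ n - i := by omega
      positivity
    · rfl
  refine cartanPosDef_of_neighbor_sum (fun x => u x) (fun x => ?_) fun x => ?_
  · simp only [hu, x.2, if_true]
    have : (0 : ℤ) < n - (x : ℕ) := by omega
    positivity
  obtain ⟨x, hx⟩ := x
  rcases x with _ | x
  · refine lt_of_le_of_lt (sum_ite_le_sum_list n u hu0 _ [1] fun y hy => ?_) ?_
    · rw [SimpleGraph.pathGraph_adj] at hy
      simp at hy ⊢
      omega
    · simp only [hu, List.map_cons, List.map_nil, List.sum_cons, List.sum_nil]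
      split_ifs <;> push_cast <;> omega
  · refine lt_of_le_of_lt (sum_ite_le_sum_list n u hu0 _ [x, x + 2] fun y hy => ?_) ?_
    · rw [SimpleGraph.pathGraph_adj] at hy
      simp at hy ⊢
      omega
    · simp only [hu, List.map_cons, List.map_nil, List.sum_cons, List.sum_nil]
      rw [if_pos (by omega), if_pos hx]
      split_ifs
      · push_cast
        nlinarith
      · have : (n : ℤ) = x + 2 := by omega
        rw [this]
        push_cast
        nlinarith

theorem forkGraph_adj {n b : ℕ} {i j : Fin n} : (forkGraph n b).Adj i j ↔ i ≠ j ∧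
    ((((i : ℕ) + 1 = j ∧ (j : ℕ) + 1 < n) ∨ ((i : ℕ) = b ∧ (j : ℕ) + 1 = n)) ∨
    (((j : ℕ) + 1 = i ∧ (i : ℕ) + 1 < n) ∨ ((j : ℕ) = b ∧ (i : ℕ) + 1 = n))) := by
  rw [forkGraph, SimpleGraph.fromRel_adj]

theorem cartanPosDef_forkGraph_D (n : ℕ) (hn : 4 ≤ n) : CartanPosDef (forkGraph n (n - 3)) := by
  classical
  -- Twice the sum of the positive roots of D_n; the factor 2 avoids the fraction n(n - 1)/2 at the
  -- two short ends. The Cartan matrix maps it to the constant vector 4.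
  set u : ℕ → ℤ := fun i => if i + 2 < n then 2 * (i + 1) * (2 * n - 2 - i) else n * (n - 1) with hu
  have hu0 : ∀ i, 0 < u i := fun i => by
    simp only [hu]
    split_ifs with h
    · have : (0 : ℤ) < 2 * n - 2 - i := by omega
      positivity
    · have : (0 : ℤ) < n - 1 := by omega
      have : (0 : ℤ) < n := by omega
      positivity
  refine cartanPosDef_of_neighbor_sum (fun x => u x) (fun x => hu0 x) fun x => ?_
  have key : ∀ l : List ℕ, (∀ y, (forkGraph n (n - 3)).Adj x y → (y : ℕ) ∈ l) →
      (l.map u).sum < 2 * u x →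
      ∑ y : Fin n, (if (forkGraph n (n - 3)).Adj x y then u y else 0) < 2 * u x := fun l hl h =>
    lt_of_le_of_lt (sum_ite_le_sum_list n u (fun i => (hu0 i).le) _ l hl) h
  obtain ⟨x, hx⟩ := x
  simp only at key ⊢
  obtain ⟨m, rfl⟩ : ∃ m, n = m + 4 := ⟨n - 4, by omega⟩
  by_cases h1 : x = m + 3
  · refine key [m + 1] (fun y hy => ?_) ?_
    · rw [forkGraph_adj] at hy
      simp at hy ⊢
      omega
    · simp [hu, h1]
      nlinarith
  by_cases h2 : x = m + 2
  · refine key [m + 1] (fun y hy => ?_) ?_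
    · rw [forkGraph_adj] at hy
      simp at hy ⊢
      omega
    · simp [hu, h2]
      nlinarith
  by_cases h3 : x = m + 1
  · refine key [m, m + 2, m + 3] (fun y hy => ?_) ?_
    · rw [forkGraph_adj] at hy
      simp at hy ⊢
      omega
    · simp [hu, h3]
      nlinarith
  by_cases h4 : x = 0
  · refine key [1] (fun y hy => ?_) ?_
    · rw [forkGraph_adj] at hy
      simp at hy ⊢
      omega
    · simp [hu, h4]
      nlinarith
  obtain ⟨k, rfl⟩ : ∃ k, x = k + 1 := ⟨x - 1, by omega⟩
  refine key [k, k + 2] (fun y hy => ?_) ?_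
  · rw [forkGraph_adj] at hy
    simp at hy ⊢
    omega
  · simp only [hu, List.map_cons, List.map_nil, List.sum_cons, List.sum_nil]
    rw [if_pos (by omega), if_pos (by omega), if_pos (by omega)]
    push_cast
    nlinarith

theorem cartanPosDef_forkGraph_E (n : ℕ) (hn : n = 6 ∨ n = 7 ∨ n = 8) :
    CartanPosDef (forkGraph n 2) := by
  classical
  have key : ∀ (n : ℕ) (w : Fin n → ℤ), (∀ x, 0 < w x) →
      (∀ x : Fin n, (∑ y : Fin n, if x ≠ y ∧
        ((((x : ℕ) + 1 = y ∧ (y : ℕ) + 1 < n) ∨ ((x : ℕ) = 2 ∧ (y : ℕ) + 1 = n)) ∨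
        (((y : ℕ) + 1 = x ∧ (x : ℕ) + 1 < n) ∨ ((y : ℕ) = 2 ∧ (x : ℕ) + 1 = n)))
        then w y else 0) < 2 * w x) → CartanPosDef (forkGraph n 2) := fun n w hw h =>
    cartanPosDef_of_neighbor_sum w hw fun x => by simpa only [forkGraph_adj] using h x
  rcases hn with rfl | rfl | rfl
  -- The vectors are again the sums of the positive roots, with the last entry at the extra vertex;
  -- the Cartan matrix maps each to the constant vector 2.
  · exact key 6 ![16, 30, 42, 30, 16, 22] (by decide) (by decide)
  · exact key 7 ![34, 66, 96, 75, 52, 27, 49] (by decide) (by decide)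
  · exact key 8 ![92, 182, 270, 220, 168, 114, 58, 136] (by decide) (by decide)

theorem IsFiniteSimplyLacedDynkin.cartanPosDef (h : IsFiniteSimplyLacedDynkin Γ) :
    CartanPosDef Γ := by
  rcases h with ⟨n, -, ⟨f⟩⟩ | ⟨n, hn, ⟨f⟩⟩ | ⟨n, hn, ⟨f⟩⟩
  · exact (cartanPosDef_pathGraph n).of_iso f
  · exact (cartanPosDef_forkGraph_D n hn).of_iso f
  · exact (cartanPosDef_forkGraph_E n hn).of_iso f

end Dynkin

/-! ### The sign cocycle on the root lattice -/

section Cocycle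

variable {V : Type v} [Fintype V] [DecidableEq V] (Γ : SimpleGraph V)

/-- The upper triangular integral matrix whose symmetrization is the Cartan matrix, with respect
to some enumeration of the vertices. -/
noncomputable def triangularMatrix (x y : V) : ℤ :=
  if x = y then 1 else if Fintype.equivFin V x < Fintype.equivFin V y then cartanMatrix Γ x y else 0

theorem triangularMatrix_add (x y : V) :
    triangularMatrix Γ x y + triangularMatrix Γ y x = cartanMatrix Γ x y := by
  rcases eq_or_ne x y with rfl | h
  · simp [triangularMatrix, cartanMatrix_self]
  · simp only [triangularMatrix, if_neg h, if_neg h.symm]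
    rcases lt_or_gt_of_ne ((Fintype.equivFin V).injective.ne h) with h' | h'
    · rw [if_pos h', if_neg h'.not_gt, add_zero]
    · rw [if_neg h'.not_gt, if_pos h', zero_add, cartanMatrix_comm]

/-- The bilinear form of the triangular matrix. -/
noncomputable def triangularForm (β γ : V → ℤ) : ℤ :=
  ∑ x, ∑ y, β x * triangularMatrix Γ x y * γ y

theorem triangularForm_add_swap (β γ : V → ℤ) :
    triangularForm Γ β γ + triangularForm Γ γ β = pairing Γ β γ := by
  rw [triangularForm, triangularForm, Finset.sum_comm (f := fun x y => γ x * _ * β y), pairing,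
    ← Finset.sum_add_distrib]
  refine Finset.sum_congr rfl fun x _ => ?_
  rw [← Finset.sum_add_distrib]
  refine Finset.sum_congr rfl fun y _ => ?_
  rw [← triangularMatrix_add]; ring

/-- The sign cocycle. -/
noncomputable def sgn (β γ : V → ℤ) : ℂ := (-1) ^ triangularForm Γ β γ

theorem sgn_add_left (β γ δ : V → ℤ) : sgn Γ (β + γ) δ = sgn Γ β δ * sgn Γ γ δ := by
  rw [sgn, sgn, sgn, ← zpow_add₀ (by norm_num)]
  simp [triangularForm, add_mul, Finset.sum_add_distrib]

theorem sgn_add_right (β γ δ : V → ℤ) : sgn Γ β (γ + δ) = sgn Γ β γ * sgn Γ β δ := by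
  rw [sgn, sgn, sgn, ← zpow_add₀ (by norm_num)]
  simp [triangularForm, mul_add, Finset.sum_add_distrib]

theorem sgn_eq_or (β γ : V → ℤ) : sgn Γ β γ = 1 ∨ sgn Γ β γ = -1 := by
  rcases Int.even_or_odd (triangularForm Γ β γ) with h | h
  · exact Or.inl h.neg_one_zpow
  · exact Or.inr h.neg_one_zpow

theorem sgn_mul_self (β γ : V → ℤ) : sgn Γ β γ * sgn Γ β γ = 1 := by
  rcases sgn_eq_or Γ β γ with h | h <;> simp [h]

theorem sgn_neg_left (β γ : V → ℤ) : sgn Γ (-β) γ = sgn Γ β γ := by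
  have h : sgn Γ (-β + β) γ = 1 := by simp [sgn, triangularForm]
  rw [sgn_add_left] at h
  calc sgn Γ (-β) γ = sgn Γ (-β) γ * sgn Γ β γ * sgn Γ β γ := by
        rw [mul_assoc, sgn_mul_self, mul_one]
    _ = sgn Γ β γ := by rw [h, one_mul]

theorem sgn_neg_right (β γ : V → ℤ) : sgn Γ β (-γ) = sgn Γ β γ := by
  have h : sgn Γ β (-γ + γ) = 1 := by simp [sgn, triangularForm]
  rw [sgn_add_right] at h
  calc sgn Γ β (-γ) = sgn Γ β (-γ) * sgn Γ β γ * sgn Γ β γ := by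
        rw [mul_assoc, sgn_mul_self, mul_one]
    _ = sgn Γ β γ := by rw [h, one_mul]

/-- The triangular form symmetrizes to the Cartan form, so exchanging the arguments costs the parity
of the pairing. When the sum of two roots is a root this parity is odd, which makes the bracket
antisymmetric. -/
theorem sgn_mul_swap (β γ : V → ℤ) : sgn Γ β γ * sgn Γ γ β = (-1) ^ pairing Γ β γ := by
  rw [sgn, sgn, ← zpow_add₀ (by norm_num), triangularForm_add_swap]

variable {Γ}

theorem sgn_self {β : V → ℤ} (hβ : β ∈ normTwo Γ) : sgn Γ β β = -1 := by
  have h : pairing Γ β β = 2 := hβ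
  rw [← triangularForm_add_swap] at h
  rw [sgn, show triangularForm Γ β β = 1 by omega, zpow_one]

theorem sgn_swap_of_even {β γ : V → ℤ} (h : Even (pairing Γ β γ)) : sgn Γ γ β = sgn Γ β γ := by
  have h1 := sgn_mul_swap Γ β γ
  rw [h.neg_one_zpow] at h1
  calc sgn Γ γ β = sgn Γ β γ * sgn Γ β γ * sgn Γ γ β := by rw [sgn_mul_self, one_mul]
    _ = sgn Γ β γ := by rw [mul_assoc, h1, mul_one]

theorem sgn_swap_of_odd {β γ : V → ℤ} (h : Odd (pairing Γ β γ)) : sgn Γ γ β = -sgn Γ β γ := by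
  have h1 := sgn_mul_swap Γ β γ
  rw [h.neg_one_zpow] at h1
  calc sgn Γ γ β = sgn Γ β γ * sgn Γ β γ * sgn Γ γ β := by rw [sgn_mul_self, one_mul]
    _ = -sgn Γ β γ := by rw [mul_assoc, h1, mul_neg_one]

end Cocycle

/-! ### The simply laced Lie algebra of the cocycle -/

section Model

variable {V : Type v} (Γ : SimpleGraph V) [Fintype V] [DecidableEq V]

/-- The vector space with basis the vertices and the vectors of norm two, which carries the simply
laced Lie algebra of the sign cocycle. -/
def CocycleAlgebra : Type v := (V ⊕ normTwo Γ) →₀ ℂ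

namespace CocycleAlgebra

noncomputable instance : AddCommGroup (CocycleAlgebra Γ) :=
  inferInstanceAs (AddCommGroup ((V ⊕ normTwo Γ) →₀ ℂ))

noncomputable instance : Module ℂ (CocycleAlgebra Γ) :=
  inferInstanceAs (Module ℂ ((V ⊕ normTwo Γ) →₀ ℂ))

/-- The standard basis. -/
noncomputable def basis : Module.Basis (V ⊕ normTwo Γ) ℂ (CocycleAlgebra Γ) :=
  .ofRepr (LinearEquiv.refl ℂ ((V ⊕ normTwo Γ) →₀ ℂ))

/-- The Cartan element of a weight. -/
noncomputable def cartan (β : V → ℤ) : CocycleAlgebra Γ := ∑ x, (β x : ℂ) • basis Γ (.inl x)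

open scoped Classical in
/-- The root vector of `β` if `β` has norm two, and zero otherwise. -/
noncomputable def root (β : V → ℤ) : CocycleAlgebra Γ :=
  if h : β ∈ normTwo Γ then basis Γ (.inr ⟨β, h⟩) else 0

/-- The bracket on the standard basis. -/
noncomputable def basisBracket : V ⊕ normTwo Γ → V ⊕ normTwo Γ → CocycleAlgebra Γ
  | .inl _, .inl _ => 0
  | .inl x, .inr β => (pairing Γ (simpleRoot x) β : ℂ) • root Γ β
  | .inr β, .inl x => -((pairing Γ (simpleRoot x) β : ℂ) • root Γ β)
  | .inr β, .inr γ => sgn Γ β γ •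
      if (β : V → ℤ) + γ = 0 then cartan Γ β else root Γ ((β : V → ℤ) + γ)

/-- The bracket as a bilinear map. -/
noncomputable def bracketHom :
    CocycleAlgebra Γ →ₗ[ℂ] CocycleAlgebra Γ →ₗ[ℂ] CocycleAlgebra Γ :=
  (basis Γ).constr ℂ fun i => (basis Γ).constr ℂ fun j => basisBracket Γ i j

noncomputable instance : Bracket (CocycleAlgebra Γ) (CocycleAlgebra Γ) :=
  ⟨fun a b => bracketHom Γ a b⟩

theorem basis_lie_basis (i j : V ⊕ normTwo Γ) :
    ⁅basis Γ i, basis Γ j⁆ = basisBracket Γ i j := by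
  change bracketHom Γ (basis Γ i) (basis Γ j) = _
  simp [bracketHom, Module.Basis.constr_basis]

theorem bracket_add (a b c : CocycleAlgebra Γ) : ⁅a, b + c⁆ = ⁅a, b⁆ + ⁅a, c⁆ :=
  map_add (bracketHom Γ a) b c

theorem add_bracket (a b c : CocycleAlgebra Γ) : ⁅a + b, c⁆ = ⁅a, c⁆ + ⁅b, c⁆ :=
  LinearMap.map_add₂ (bracketHom Γ) a b c

theorem bracket_smul (r : ℂ) (a b : CocycleAlgebra Γ) : ⁅a, r • b⁆ = r • ⁅a, b⁆ :=
  map_smul (bracketHom Γ a) r b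

theorem smul_bracket (r : ℂ) (a b : CocycleAlgebra Γ) : ⁅r • a, b⁆ = r • ⁅a, b⁆ :=
  LinearMap.map_smul₂ (bracketHom Γ) r a b

theorem bracket_zero (a : CocycleAlgebra Γ) : ⁅a, (0 : CocycleAlgebra Γ)⁆ = 0 :=
  map_zero (bracketHom Γ a)

theorem zero_bracket (a : CocycleAlgebra Γ) : ⁅(0 : CocycleAlgebra Γ), a⁆ = 0 :=
  LinearMap.map_zero₂ (bracketHom Γ) a

theorem bracket_neg (a b : CocycleAlgebra Γ) : ⁅a, -b⁆ = -⁅a, b⁆ :=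
  map_neg (bracketHom Γ a) b

theorem bracket_sum {ι : Type*} (s : Finset ι) (a : CocycleAlgebra Γ) (b : ι → CocycleAlgebra Γ) :
    ⁅a, ∑ i ∈ s, b i⁆ = ∑ i ∈ s, ⁅a, b i⁆ :=
  map_sum (bracketHom Γ a) b s

theorem sum_bracket {ι : Type*} (s : Finset ι) (a : ι → CocycleAlgebra Γ) (b : CocycleAlgebra Γ) :
    ⁅∑ i ∈ s, a i, b⁆ = ∑ i ∈ s, ⁅a i, b⁆ :=
  map_sum ((bracketHom Γ).flip b) a s

theorem cartan_simpleRoot (x : V) : cartan Γ (simpleRoot x) = basis Γ (.inl x) := by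
  rw [cartan, Finset.sum_eq_single x]
  · simp [simpleRoot]
  · intro y _ h
    simp [simpleRoot, h]
  · simp

theorem cartan_add (β γ : V → ℤ) : cartan Γ (β + γ) = cartan Γ β + cartan Γ γ := by
  simp [cartan, add_smul, Finset.sum_add_distrib]

theorem cartan_neg (β : V → ℤ) : cartan Γ (-β) = -cartan Γ β := by
  simp [cartan]

variable {Γ}

theorem root_of_mem {β : V → ℤ} (h : β ∈ normTwo Γ) : root Γ β = basis Γ (.inr ⟨β, h⟩) :=
  dif_pos h

theorem root_coe (β : normTwo Γ) : root Γ β = basis Γ (.inr β) := root_of_mem β.2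

theorem root_of_not_mem {β : V → ℤ} (h : β ∉ normTwo Γ) : root Γ β = 0 := dif_neg h

theorem cartan_bracket_cartan (β γ : V → ℤ) : ⁅cartan Γ β, cartan Γ γ⁆ = 0 := by
  simp only [cartan, sum_bracket, bracket_sum, smul_bracket, bracket_smul, basis_lie_basis,
    basisBracket, smul_zero, Finset.sum_const_zero]

theorem cartan_bracket_root (β γ : V → ℤ) :
    ⁅cartan Γ β, root Γ γ⁆ = (pairing Γ β γ : ℂ) • root Γ γ := by
  by_cases h : γ ∈ normTwo Γ
  · rw [root_of_mem h]
    simp only [cartan, sum_bracket, smul_bracket, basis_lie_basis, basisBracket, root_of_mem h]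
    rw [pairing_eq_sum_simpleRoot]
    simp [Finset.sum_smul, mul_smul]
  · rw [root_of_not_mem h, bracket_zero, smul_zero]

theorem root_bracket_cartan (β γ : V → ℤ) :
    ⁅root Γ γ, cartan Γ β⁆ = -((pairing Γ β γ : ℂ) • root Γ γ) := by
  by_cases h : γ ∈ normTwo Γ
  · rw [root_of_mem h]
    simp only [cartan, bracket_sum, bracket_smul, basis_lie_basis, basisBracket, root_of_mem h]
    rw [pairing_eq_sum_simpleRoot]
    simp [Finset.sum_smul, mul_smul]
  · rw [root_of_not_mem h, zero_bracket, smul_zero, neg_zero]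

theorem root_bracket_root {β γ : V → ℤ} (hβ : β ∈ normTwo Γ) (hγ : γ ∈ normTwo Γ)
    (h : β + γ ≠ 0) : ⁅root Γ β, root Γ γ⁆ = sgn Γ β γ • root Γ (β + γ) := by
  rw [root_of_mem hβ, root_of_mem hγ, basis_lie_basis, basisBracket, if_neg h]

/-- The cocycle is -1 on (β, -β). This sign accounts for the minus sign in the image of `F_x` and
for the later rescaling by `rootSign`. -/
theorem root_bracket_root_neg {β : V → ℤ} (hβ : β ∈ normTwo Γ) :
    ⁅root Γ β, root Γ (-β)⁆ = -cartan Γ β := by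
  rw [root_of_mem hβ, root_of_mem (neg_mem_normTwo hβ), basis_lie_basis, basisBracket,
    if_pos (add_neg_cancel β), sgn_neg_right, sgn_self hβ, neg_one_smul]

/-- The sum has norm at least 4, so it is neither zero nor of norm two. -/
theorem root_bracket_eq_zero {β γ : V → ℤ} (hβ : β ∈ normTwo Γ) (hγ : γ ∈ normTwo Γ)
    (h : 0 ≤ pairing Γ β γ) : ⁅root Γ β, root Γ γ⁆ = 0 := by
  have h0 : β + γ ≠ 0 := fun h0 => by
    rw [eq_neg_of_add_eq_zero_left h0, pairing_neg_left, show pairing Γ γ γ = 2 from hγ] at h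
    omega
  rw [root_bracket_root hβ hγ h0, root_of_not_mem, smul_zero]
  rw [add_mem_normTwo_iff hβ hγ]
  omega

theorem root_bracket_swap {β γ : V → ℤ} (hβ : β ∈ normTwo Γ) (hγ : γ ∈ normTwo Γ) :
    ⁅root Γ β, root Γ γ⁆ = -⁅root Γ γ, root Γ β⁆ := by
  by_cases h : β + γ = 0
  · obtain rfl := eq_neg_of_add_eq_zero_right h
    have h1 := root_bracket_root_neg hγ
    rw [neg_neg] at h1
    rw [root_bracket_root_neg hβ, h1, cartan_neg, neg_neg]
  · rw [root_bracket_root hβ hγ h, root_bracket_root hγ hβ (by rwa [add_comm]), add_comm γ β]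
    by_cases hm : β + γ ∈ normTwo Γ
    · rw [sgn_swap_of_odd (β := β) (γ := γ) (by
        rw [(add_mem_normTwo_iff hβ hγ).1 hm]; decide), neg_smul, neg_neg]
    · rw [root_of_not_mem hm, smul_zero, smul_zero, neg_zero]

theorem basis_induction {p : CocycleAlgebra Γ → Prop} (a : CocycleAlgebra Γ)
    (hcartan : ∀ β, p (cartan Γ β)) (hroot : ∀ β ∈ normTwo Γ, p (root Γ β)) (hzero : p 0)
    (hadd : ∀ a b, p a → p b → p (a + b)) (hsmul : ∀ (r : ℂ) a, p a → p (r • a)) : p a := by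
  have h : a ∈ Submodule.span ℂ (Set.range (basis Γ)) := (basis Γ).mem_span a
  induction h using Submodule.span_induction with
  | mem a ha =>
    obtain ⟨x | β, rfl⟩ := ha
    · rw [← cartan_simpleRoot]; exact hcartan _
    · rw [← root_coe]; exact hroot _ β.2
  | zero => exact hzero
  | add a b _ _ ha hb => exact hadd a b ha hb
  | smul r a _ ha => exact hsmul r a ha

theorem bracket_swap (a b : CocycleAlgebra Γ) : ⁅a, b⁆ = -⁅b, a⁆ := by
  induction a using basis_induction with
  | hzero => rw [zero_bracket, bracket_zero, neg_zero]
  | hadd a a' h h' => rw [add_bracket, bracket_add, h, h', neg_add]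
  | hsmul r a h => rw [smul_bracket, bracket_smul, h, smul_neg]
  | hcartan β =>
    induction b using basis_induction with
    | hzero => rw [zero_bracket, bracket_zero, neg_zero]
    | hadd b b' h h' => rw [add_bracket, bracket_add, h, h', neg_add]
    | hsmul r b h => rw [smul_bracket, bracket_smul, h, smul_neg]
    | hcartan γ => rw [cartan_bracket_cartan, cartan_bracket_cartan, neg_zero]
    | hroot γ _ => rw [cartan_bracket_root, root_bracket_cartan, neg_neg]
  | hroot β hβ =>
    induction b using basis_induction with
    | hzero => rw [zero_bracket, bracket_zero, neg_zero]
    | hadd b b' h h' => rw [add_bracket, bracket_add, h, h', neg_add]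
    | hsmul r b h => rw [smul_bracket, bracket_smul, h, smul_neg]
    | hcartan γ => rw [cartan_bracket_root, root_bracket_cartan]
    | hroot γ hγ => exact root_bracket_swap hβ hγ

/-- The cyclic sum of the Jacobi identity. -/
noncomputable def jacobiator (a b c : CocycleAlgebra Γ) : CocycleAlgebra Γ :=
  ⁅a, ⁅b, c⁆⁆ + ⁅b, ⁅c, a⁆⁆ + ⁅c, ⁅a, b⁆⁆

theorem jacobiator_rotate (a b c : CocycleAlgebra Γ) : jacobiator a b c = jacobiator b c a := by
  rw [jacobiator, jacobiator]; abel

theorem jacobiator_swap (a b c : CocycleAlgebra Γ) : jacobiator a b c = -jacobiator b a c := by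
  rw [jacobiator, jacobiator, bracket_swap b c, bracket_swap a b, bracket_swap c a]
  simp only [bracket_neg]
  abel

/-- Cartan elements act by weights, and the bracket of two root vectors has the sum of their
weights, also when that sum is 0. -/
theorem jacobiator_cartan_root_root (β : V → ℤ) {γ δ : V → ℤ} (hγ : γ ∈ normTwo Γ)
    (hδ : δ ∈ normTwo Γ) : jacobiator (cartan Γ β) (root Γ γ) (root Γ δ) = 0 := by
  have h : ⁅cartan Γ β, ⁅root Γ γ, root Γ δ⁆⁆
      = (pairing Γ β (γ + δ) : ℂ) • ⁅root Γ γ, root Γ δ⁆ := by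
    by_cases h0 : γ + δ = 0
    · obtain rfl := eq_neg_of_add_eq_zero_right h0
      rw [root_bracket_root_neg hγ, bracket_neg, cartan_bracket_cartan, h0, pairing_zero_right,
        Int.cast_zero, zero_smul, neg_zero]
    · rw [root_bracket_root hγ hδ h0, bracket_smul, cartan_bracket_root, smul_comm]
  rw [jacobiator, h, root_bracket_cartan, cartan_bracket_root, bracket_neg, bracket_smul,
    bracket_smul, bracket_swap (root Γ δ), pairing_add_right, Int.cast_add, add_smul, smul_neg]
  abel

/-- The sign assumption kills [γ, β], leaving pairings 0, 1, 2. For pairing 1, the bracket with -β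
and then with β involves each cocycle sign twice, up to the value -1 on (β, β). -/
theorem jacobiator_root_neg (hp : CartanPosDef Γ) {β γ : V → ℤ} (hβ : β ∈ normTwo Γ)
    (hγ : γ ∈ normTwo Γ) (h : 0 ≤ pairing Γ β γ) :
    jacobiator (root Γ β) (root Γ (-β)) (root Γ γ) = 0 := by
  have hle := hp.pairing_le_two hβ hγ
  have h0 : ⁅root Γ γ, root Γ β⁆ = 0 := root_bracket_eq_zero hγ hβ (by rwa [pairing_comm])
  rw [jacobiator, h0, bracket_zero, add_zero, root_bracket_root_neg hβ, bracket_neg,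
    root_bracket_cartan, neg_neg]
  obtain h2 | h1 | h0 : pairing Γ β γ = 2 ∨ pairing Γ β γ = 1 ∨ pairing Γ β γ = 0 := by omega
  · obtain rfl := hp.eq_of_pairing_eq_two hβ hγ h2
    have h3 := root_bracket_root_neg (neg_mem_normTwo hβ)
    rw [neg_neg] at h3
    rw [h3, cartan_neg, neg_neg, root_bracket_cartan, neg_add_cancel]
  · have hm : -β + γ ∈ normTwo Γ := (add_mem_normTwo_iff (neg_mem_normTwo hβ) hγ).2
      (by rw [pairing_neg_left, h1])
    rw [root_bracket_root (neg_mem_normTwo hβ) hγ (ne_zero_of_mem_normTwo hm), bracket_smul,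
      root_bracket_root hβ hm (by rw [add_neg_cancel_left]; exact ne_zero_of_mem_normTwo hγ),
      add_neg_cancel_left, smul_smul, sgn_add_right, sgn_neg_left, sgn_neg_right, sgn_self hβ,
      mul_left_comm, sgn_mul_self, mul_one, h1, ← add_smul]
    simp
  · rw [root_bracket_eq_zero (neg_mem_normTwo hβ) hγ (by rw [pairing_neg_left, h0]; rfl), h0,
      bracket_zero]
    simp

theorem jacobiator_root_of_add_eq_zero (hp : CartanPosDef Γ) {β γ δ : V → ℤ}
    (hβ : β ∈ normTwo Γ) (hγ : γ ∈ normTwo Γ) (hδ : δ ∈ normTwo Γ) (h : β + γ = 0) :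
    jacobiator (root Γ β) (root Γ γ) (root Γ δ) = 0 := by
  obtain rfl := eq_neg_of_add_eq_zero_right h
  rcases le_total 0 (pairing Γ β δ) with h0 | h0
  · exact jacobiator_root_neg hp hβ hδ h0
  · have h1 := jacobiator_root_neg hp hγ hδ (by rw [pairing_neg_left]; omega)
    rw [neg_neg] at h1
    rw [jacobiator_swap, h1, neg_zero]

theorem root_bracket_bracket {β γ δ : V → ℤ} (hβ : β ∈ normTwo Γ) (hγ : γ ∈ normTwo Γ)
    (hδ : δ ∈ normTwo Γ) (h1 : γ + δ ≠ 0) (h2 : β + γ + δ ≠ 0) (h3 : pairing Γ γ δ = -1) :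
    ⁅root Γ β, ⁅root Γ γ, root Γ δ⁆⁆
      = (sgn Γ γ δ * (sgn Γ β γ * sgn Γ β δ)) • root Γ (β + γ + δ) := by
  rw [root_bracket_root hγ hδ h1, bracket_smul, root_bracket_root hβ
    ((add_mem_normTwo_iff hγ hδ).2 h3) (by rwa [← add_assoc]), smul_smul, sgn_add_right, add_assoc]

theorem root_bracket_bracket_eq_zero {β γ δ : V → ℤ} (hβ : β ∈ normTwo Γ) (hγ : γ ∈ normTwo Γ)
    (hδ : δ ∈ normTwo Γ) (h1 : γ + δ ≠ 0) (h2 : β + γ + δ ≠ 0) (h3 : β + γ + δ ∉ normTwo Γ) :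
    ⁅root Γ β, ⁅root Γ γ, root Γ δ⁆⁆ = 0 := by
  by_cases h : pairing Γ γ δ = -1
  · rw [root_bracket_bracket hβ hγ hδ h1 h2 h, root_of_not_mem h3, smul_zero]
  · rw [root_bracket_root hγ hδ h1, root_of_not_mem ((add_mem_normTwo_iff hγ hδ).not.2 h),
      smul_zero, bracket_zero]

/-- Two double brackets survive. Their coefficients differ by one swap across an odd pairing and one
across an even pairing, so they cancel. -/
theorem jacobiator_root_of_pairing_eq_zero {β γ δ : V → ℤ} (hβ : β ∈ normTwo Γ)
    (hγ : γ ∈ normTwo Γ) (hδ : δ ∈ normTwo Γ) (h1 : β + γ ≠ 0) (h2 : γ + δ ≠ 0)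
    (h0 : β + γ + δ ≠ 0) (hβγ : pairing Γ β γ = -1) (hγδ : pairing Γ γ δ = -1)
    (hδβ : pairing Γ δ β = 0) : jacobiator (root Γ β) (root Γ γ) (root Γ δ) = 0 := by
  have e : δ + β + γ = β + γ + δ := by abel
  rw [jacobiator, root_bracket_eq_zero hδ hβ hδβ.ge, bracket_zero, add_zero,
    root_bracket_bracket hβ hγ hδ h2 h0 hγδ, root_bracket_bracket hδ hβ hγ h1 (by rwa [e]) hβγ, e,
    ← add_smul, sgn_swap_of_odd (β := γ) (γ := δ) (by rw [hγδ]; decide),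
    sgn_swap_of_even (β := δ) (γ := β) (by rw [hδβ]; exact Even.zero)]
  rw [show ∀ r s t : ℂ, r * (s * t) + s * (t * -r) = 0 by intros; ring, zero_smul]

/-- Each double bracket is a Cartan element, all three with the same sign, and the three weights add
up to 0. -/
theorem jacobiator_root_of_sum_eq_zero {β γ δ : V → ℤ} (hβ : β ∈ normTwo Γ)
    (hγ : γ ∈ normTwo Γ) (hδ : δ ∈ normTwo Γ) (h0 : β + γ + δ = 0) :
    jacobiator (root Γ β) (root Γ γ) (root Γ δ) = 0 := by
  obtain rfl := eq_neg_of_add_eq_zero_right h0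
  have hm : β + γ ∈ normTwo Γ := by simpa using neg_mem_normTwo hδ
  have hpair := (add_mem_normTwo_iff hβ hγ).1 hm
  have e1 : γ + -(β + γ) = -β := by abel
  have e2 : -(β + γ) + β = -γ := by abel
  have n1 : -β ≠ 0 := neg_ne_zero.2 (ne_zero_of_mem_normTwo hβ)
  have n2 : -γ ≠ 0 := neg_ne_zero.2 (ne_zero_of_mem_normTwo hγ)
  have h3 := root_bracket_root_neg (neg_mem_normTwo hm)
  rw [neg_neg] at h3
  rw [jacobiator, root_bracket_root hγ hδ (by rwa [e1]), root_bracket_root hδ hβ (by rwa [e2]),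
    root_bracket_root hβ hγ (ne_zero_of_mem_normTwo hm), e1, e2, bracket_smul, bracket_smul,
    bracket_smul, root_bracket_root_neg hβ, root_bracket_root_neg hγ, h3, cartan_neg, cartan_add,
    sgn_neg_left, sgn_neg_right, sgn_add_left, sgn_add_right, sgn_self hβ, sgn_self hγ,
    sgn_swap_of_odd (β := β) (γ := γ) (by rw [hpair]; decide)]
  simp only [mul_neg_one, neg_neg, smul_neg, smul_add, one_mul, neg_mul]
  abel

/-- Apart from opposite pairs and zero sums, a double bracket can be nonzero only if the total
weight has norm two. Then two of the three pairings are -1 and the third is 0. -/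
theorem jacobiator_root_root_root (hp : CartanPosDef Γ) {β γ δ : V → ℤ} (hβ : β ∈ normTwo Γ)
    (hγ : γ ∈ normTwo Γ) (hδ : δ ∈ normTwo Γ) :
    jacobiator (root Γ β) (root Γ γ) (root Γ δ) = 0 := by
  by_cases h1 : β + γ = 0
  · exact jacobiator_root_of_add_eq_zero hp hβ hγ hδ h1
  by_cases h2 : γ + δ = 0
  · rw [jacobiator_rotate]
    exact jacobiator_root_of_add_eq_zero hp hγ hδ hβ h2
  by_cases h3 : δ + β = 0
  · rw [← jacobiator_rotate]
    exact jacobiator_root_of_add_eq_zero hp hδ hβ hγ h3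
  by_cases h0 : β + γ + δ = 0
  · exact jacobiator_root_of_sum_eq_zero hβ hγ hδ h0
  have e1 : γ + δ + β = β + γ + δ := by abel
  have e2 : δ + β + γ = β + γ + δ := by abel
  by_cases hm : β + γ + δ ∈ normTwo Γ
  · have key : ∀ {β γ : V → ℤ}, β ∈ normTwo Γ → γ ∈ normTwo Γ → β + γ ≠ 0 →
        -1 ≤ pairing Γ β γ := fun {β γ} hβ hγ h => by
      have l := hp.neg_two_le_pairing hβ hγ
      have n : pairing Γ β γ ≠ -2 := fun h' => h (by
        rw [hp.eq_neg_of_pairing_eq_neg_two hβ hγ h', neg_add_cancel])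
      omega
    have l1 := key hβ hγ h1
    have l2 := key hγ hδ h2
    have l3 := key hδ hβ h3
    -- The total norm is 6 plus twice the sum of the pairings. Each pairing is at least -1, so a sum
    -- of -2 leaves only the three distributions below.
    have hs : pairing Γ β γ + pairing Γ γ δ + pairing Γ δ β = -2 := by
      have hm' : pairing Γ (β + γ + δ) (β + γ + δ) = 2 := hm
      rw [pairing_add_self, pairing_add_self, pairing_add_left, show pairing Γ β β = 2 from hβ,
        show pairing Γ γ γ = 2 from hγ, show pairing Γ δ δ = 2 from hδ, pairing_comm Γ β δ] at hm'
      omega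
    obtain ⟨a, b, c⟩ | ⟨a, b, c⟩ | ⟨a, b, c⟩ :
        (pairing Γ β γ = -1 ∧ pairing Γ γ δ = -1 ∧ pairing Γ δ β = 0) ∨
        (pairing Γ γ δ = -1 ∧ pairing Γ δ β = -1 ∧ pairing Γ β γ = 0) ∨
        (pairing Γ δ β = -1 ∧ pairing Γ β γ = -1 ∧ pairing Γ γ δ = 0) := by omega
    · exact jacobiator_root_of_pairing_eq_zero hβ hγ hδ h1 h2 h0 a b c
    · rw [jacobiator_rotate]
      exact jacobiator_root_of_pairing_eq_zero hγ hδ hβ h2 h3 (by rwa [e1]) a b c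
    · rw [← jacobiator_rotate]
      exact jacobiator_root_of_pairing_eq_zero hδ hβ hγ h3 h1 (by rwa [e2]) a b c
  · rw [jacobiator, root_bracket_bracket_eq_zero hβ hγ hδ h2 h0 hm,
      root_bracket_bracket_eq_zero hγ hδ hβ h3 (by rwa [e1]) (by rwa [e1]),
      root_bracket_bracket_eq_zero hδ hβ hγ h1 (by rwa [e2]) (by rwa [e2]), add_zero, add_zero]

theorem jacobiator_add (a b c c' : CocycleAlgebra Γ) :
    jacobiator a b (c + c') = jacobiator a b c + jacobiator a b c' := by
  simp only [jacobiator, bracket_add, add_bracket]; abel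

theorem jacobiator_smul (r : ℂ) (a b c : CocycleAlgebra Γ) :
    jacobiator a b (r • c) = r • jacobiator a b c := by
  simp only [jacobiator, bracket_smul, smul_bracket, smul_add]

theorem jacobiator_zero (a b : CocycleAlgebra Γ) : jacobiator a b 0 = 0 := by
  simp only [jacobiator, bracket_zero, zero_bracket, add_zero]

theorem jacobiator_eq_zero_of_basis {a b : CocycleAlgebra Γ}
    (hcartan : ∀ β, jacobiator a b (cartan Γ β) = 0)
    (hroot : ∀ β ∈ normTwo Γ, jacobiator a b (root Γ β) = 0) (c : CocycleAlgebra Γ) :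
    jacobiator a b c = 0 := by
  induction c using basis_induction with
  | hzero => exact jacobiator_zero _ _
  | hadd c c' h h' => rw [jacobiator_add, h, h', add_zero]
  | hsmul r c h => rw [jacobiator_smul, h, smul_zero]
  | hcartan β => exact hcartan β
  | hroot β hβ => exact hroot β hβ

theorem jacobiator_cartan_cartan (β γ : V → ℤ) (a : CocycleAlgebra Γ) :
    jacobiator (cartan Γ β) (cartan Γ γ) a = 0 := by
  refine jacobiator_eq_zero_of_basis (fun δ => ?_) (fun δ _ => ?_) a
  · simp only [jacobiator, cartan_bracket_cartan, bracket_zero, add_zero]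
  · simp only [jacobiator, cartan_bracket_cartan, bracket_zero, add_zero, cartan_bracket_root,
      root_bracket_cartan, bracket_smul, bracket_neg]
    rw [smul_comm, add_neg_cancel]

theorem jacobiator_cartan_root (β : V → ℤ) {γ : V → ℤ} (hγ : γ ∈ normTwo Γ)
    (a : CocycleAlgebra Γ) : jacobiator (cartan Γ β) (root Γ γ) a = 0 := by
  refine jacobiator_eq_zero_of_basis (fun δ => ?_) (fun δ hδ => ?_) a
  · rw [← jacobiator_rotate]
    exact jacobiator_cartan_cartan _ _ _
  · exact jacobiator_cartan_root_root β hγ hδ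

theorem jacobiator_cartan (β : V → ℤ) (a b : CocycleAlgebra Γ) :
    jacobiator (cartan Γ β) a b = 0 := by
  refine jacobiator_eq_zero_of_basis (fun δ => ?_) (fun δ hδ => ?_) b
  · rw [← jacobiator_rotate]
    exact jacobiator_cartan_cartan _ _ _
  · rw [← jacobiator_rotate, jacobiator_swap, jacobiator_cartan_root β hδ, neg_zero]

theorem jacobiator_root_root (hp : CartanPosDef Γ) {β γ : V → ℤ} (hβ : β ∈ normTwo Γ)
    (hγ : γ ∈ normTwo Γ) (a : CocycleAlgebra Γ) : jacobiator (root Γ β) (root Γ γ) a = 0 := by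
  refine jacobiator_eq_zero_of_basis (fun δ => ?_) (fun δ hδ => ?_) a
  · rw [← jacobiator_rotate]
    exact jacobiator_cartan _ _ _
  · exact jacobiator_root_root_root hp hβ hγ hδ

theorem jacobiator_eq_zero (hp : CartanPosDef Γ) (a b c : CocycleAlgebra Γ) :
    jacobiator a b c = 0 := by
  refine jacobiator_eq_zero_of_basis (fun γ => ?_) (fun γ hγ => ?_) c
  · rw [← jacobiator_rotate]
    exact jacobiator_cartan _ _ _
  · rw [← jacobiator_rotate]
    refine jacobiator_eq_zero_of_basis (fun β => ?_) (fun β hβ => ?_) b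
    · rw [← jacobiator_rotate]
      exact jacobiator_cartan _ _ _
    · rw [← jacobiator_rotate]
      exact jacobiator_root_root hp hβ hγ a

theorem bracket_self (a : CocycleAlgebra Γ) : ⁅a, a⁆ = 0 := by
  have h : (2 : ℂ) • ⁅a, a⁆ = 0 := by
    rw [two_smul]
    exact eq_neg_iff_add_eq_zero.1 (bracket_swap a a)
  exact (smul_eq_zero.1 h).resolve_left two_ne_zero

variable [hp : Fact (CartanPosDef Γ)]

noncomputable instance : LieRing (CocycleAlgebra Γ) where
  add_lie := add_bracket Γ
  lie_add := bracket_add Γ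
  lie_self := bracket_self
  leibniz_lie a b c := by
    have h := jacobiator_eq_zero hp.out a b c
    rw [jacobiator, bracket_swap c a, bracket_swap c ⁅a, b⁆, bracket_neg] at h
    rw [← sub_eq_zero, ← h]
    abel

noncomputable instance : LieAlgebra ℂ (CocycleAlgebra Γ) where
  lie_smul := bracket_smul Γ

end CocycleAlgebra

end Model

/-! ### Quotients of Lie algebras by spanned ideals -/

section Quotient

variable {R L L' : Type*} [CommRing R] [LieRing L] [LieAlgebra R L] [LieRing L'] [LieAlgebra R L']

/-- The quotient map as a homomorphism of Lie algebras. -/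
def quotientHom (I : LieIdeal R L) : L →ₗ⁅R⁆ L ⧸ I :=
  { I.toSubmodule.mkQ with
    toFun := LieSubmodule.Quotient.mk
    map_lie' := fun {_ _} => rfl }

theorem quotientHom_surjective (I : LieIdeal R L) : Function.Surjective (quotientHom I) :=
  Submodule.mkQ_surjective I.toSubmodule

/-- A homomorphism that vanishes on a set factors through the quotient by the ideal spanned by
this set. -/
theorem exists_lift_quotient {I : LieIdeal R L} {s : Set L} (hI : I = LieSubmodule.lieSpan R L s)
    (f : L →ₗ⁅R⁆ L') (hf : ∀ z ∈ s, f z = 0) :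
    ∃ g : (L ⧸ I) →ₗ⁅R⁆ L', ∀ z, g (LieSubmodule.Quotient.mk z) = f z := by
  have h : I ≤ f.ker :=
    hI ▸ LieSubmodule.lieSpan_le.2 fun z hz => (LieHom.mem_ker).2 (hf z hz)
  refine ⟨{ I.toSubmodule.liftQ (f : L →ₗ[R] L') fun z hz =>
    LieHom.mem_ker.1 (h hz) with map_lie' := fun {a b} => ?_ }, fun z => ?_⟩
  · obtain ⟨a, rfl⟩ := quotientHom_surjective _ a
    obtain ⟨b, rfl⟩ := quotientHom_surjective _ b
    exact LieHom.map_lie f a b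
  · rfl

end Quotient

/-! ### The triangular decomposition -/

section Triangular

variable {V : Type v} [Fintype V] [DecidableEq V] {Γ : SimpleGraph V} {K : Type*} [CommRing K]
  {L : Type*} [LieRing L] [LieAlgebra K L] {e f h : V → L}

theorem IsRootMonomial.lie_mem_span_singleton
    (he : ∀ x y, ⁅h x, e y⁆ ∈ Submodule.span K {e y}) {n : ℕ} {β : V → ℤ} {m : L}
    (hm : IsRootMonomial Γ e n β m) {s : L} (hs : s ∈ Submodule.span K (Set.range h)) :
    ⁅s, m⁆ ∈ Submodule.span K {m} := by
  induction hs using Submodule.span_induction with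
  | zero => simp
  | add a b _ _ ha hb => rw [add_lie]; exact add_mem ha hb
  | smul c a _ ha => rw [smul_lie]; exact Submodule.smul_mem _ c ha
  | mem s hs =>
    obtain ⟨x, rfl⟩ := hs
    induction hm with
    | gen y => exact he x y
    | lie y _ _ ih =>
      obtain ⟨c, hc⟩ := Submodule.mem_span_singleton.1 ih
      obtain ⟨d, hd⟩ := Submodule.mem_span_singleton.1 (he x y)
      rw [leibniz_lie, ← hc, ← hd, smul_lie, lie_smul, ← add_smul]
      exact Submodule.smul_mem _ _ (Submodule.mem_span_singleton_self _)

theorem lie_span_mem_rootMonomialSpan (he : ∀ x y, ⁅h x, e y⁆ ∈ Submodule.span K {e y})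
    {s : L} (hs : s ∈ Submodule.span K (Set.range h)) {z : L}
    (hz : z ∈ rootMonomialSpan Γ K e) : ⁅s, z⁆ ∈ rootMonomialSpan Γ K e := by
  induction hz using Submodule.span_induction with
  | zero => simp
  | add a b _ _ ha hb => rw [lie_add]; exact add_mem ha hb
  | smul c a _ ha => rw [lie_smul]; exact Submodule.smul_mem _ c ha
  | mem m hm =>
    obtain ⟨n, β, hm'⟩ := id hm
    exact Submodule.span_mono (Set.singleton_subset_iff.2 hm)
      (hm'.lie_mem_span_singleton he hs)

/-- In [f x, [e y, m]] = [[f x, e y], m] + [e y, [f x, m]] the first term is a Cartan element acting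
on a root monomial, and the second is handled by induction. The roles of `e` and `f` can be
exchanged, which treats both halves of the Kac-Moody algebra. -/
theorem lie_mem_span_sup_rootMonomialSpan (hp : CartanPosDef Γ)
    (hcomm : ∀ x y, ¬ Γ.Adj x y → ⁅e x, e y⁆ = 0)
    (hserre : ∀ x y, Γ.Adj x y → ⁅e x, ⁅e x, e y⁆⁆ = 0) (htors : ∀ z : L, z + z = 0 → z = 0)
    (he : ∀ x y, ⁅h x, e y⁆ ∈ Submodule.span K {e y})
    (hfe : ∀ x y, ⁅f x, e y⁆ ∈ Submodule.span K (Set.range h)) (x : V) {z : L}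
    (hz : z ∈ rootMonomialSpan Γ K e) :
    ⁅f x, z⁆ ∈ Submodule.span K (Set.range h) ⊔ rootMonomialSpan Γ K e := by
  have heh : ∀ y, ∀ s ∈ Submodule.span K (Set.range h), ⁅e y, s⁆ ∈ rootMonomialSpan Γ K e :=
    fun y s hs => by
      rw [← lie_skew]
      exact neg_mem (lie_span_mem_rootMonomialSpan he hs (gen_mem_rootMonomialSpan K y))
  induction hz using Submodule.span_induction with
  | zero => simp
  | add a b _ _ ha hb => rw [lie_add]; exact add_mem ha hb
  | smul c a _ ha => rw [lie_smul]; exact Submodule.smul_mem _ c ha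
  | mem m hm =>
    obtain ⟨n, β, hm⟩ := hm
    induction hm with
    | gen y => exact Submodule.mem_sup_left (hfe x y)
    | lie y hm' _ ih =>
      rw [leibniz_lie]
      refine Submodule.mem_sup_right (add_mem ?_ ?_)
      · exact lie_span_mem_rootMonomialSpan he (hfe x y) (Submodule.subset_span ⟨_, _, hm'⟩)
      · obtain ⟨s, hs, r, hr, hsr⟩ := Submodule.mem_sup.1 ih
        rw [← hsr, lie_add]
        exact add_mem (heh y s hs) (lie_mem_rootMonomialSpan hp K hcomm hserre htors y hr)

end Triangular

/-! ### The Kac-Moody algebra of a positive definite diagram -/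

section KacMoody

variable {V : Type v} [DecidableEq V] {Γ : SimpleGraph V}

theorem kmE_comm {x y : V} (h : ¬ Γ.Adj x y) : ⁅kmE Γ x, kmE Γ y⁆ = 0 := by
  rcases eq_or_ne x y with rfl | hxy
  · exact lie_self _
  have := kmGen_rel Γ (z := CartanMatrix.Relations.adE ℂ (cartanMatrix Γ) (x, y))
    (by simp [CartanMatrix.Relations.toSet])
  simp [CartanMatrix.Relations.adE, cartanMatrix_of_not_adj hxy h] at this
  exact this

theorem kmF_comm {x y : V} (h : ¬ Γ.Adj x y) : ⁅kmF Γ x, kmF Γ y⁆ = 0 := by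
  rcases eq_or_ne x y with rfl | hxy
  · exact lie_self _
  have := kmGen_rel Γ (z := CartanMatrix.Relations.adF ℂ (cartanMatrix Γ) (x, y))
    (by simp [CartanMatrix.Relations.toSet])
  simp [CartanMatrix.Relations.adF, cartanMatrix_of_not_adj hxy h] at this
  exact this

theorem kmE_serre {x y : V} (h : Γ.Adj x y) : ⁅kmE Γ x, ⁅kmE Γ x, kmE Γ y⁆⁆ = 0 := by
  have := kmGen_rel Γ (z := CartanMatrix.Relations.adE ℂ (cartanMatrix Γ) (x, y))
    (by simp [CartanMatrix.Relations.toSet])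
  simp [CartanMatrix.Relations.adE, cartanMatrix_of_adj h] at this
  exact this

theorem kmF_serre {x y : V} (h : Γ.Adj x y) : ⁅kmF Γ x, ⁅kmF Γ x, kmF Γ y⁆⁆ = 0 := by
  have := kmGen_rel Γ (z := CartanMatrix.Relations.adF ℂ (cartanMatrix Γ) (x, y))
    (by simp [CartanMatrix.Relations.toSet])
  simp [CartanMatrix.Relations.adF, cartanMatrix_of_adj h] at this
  exact this

theorem lie_kmE_kmF_of_ne {x y : V} (h : x ≠ y) : ⁅kmE Γ x, kmF Γ y⁆ = 0 := by
  have := kmGen_rel Γ (z := CartanMatrix.Relations.EF ℂ (x, y))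
    (by simp [CartanMatrix.Relations.toSet])
  simp [CartanMatrix.Relations.EF, h] at this
  exact this

theorem eq_zero_of_add_self_eq_zero {M : Type*} [AddCommGroup M] {K : Type*} [Field K] [Module K M]
    (hK : (2 : K) ≠ 0) (z : M) (hz : z + z = 0) : z = 0 :=
  (smul_eq_zero.1 ((two_smul K z).trans hz)).resolve_left hK

theorem kacMoody_eq_top_of_stable (S : Submodule ℂ (KacMoody Γ)) (h1 : ∀ g, kmGen Γ g ∈ S)
    (h2 : ∀ g, ∀ s ∈ S, ⁅kmGen Γ g, s⁆ ∈ S) : S = ⊤ :=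
  eq_top_of_stable (quotientHom (CartanMatrix.Relations.toIdeal ℂ (cartanMatrix Γ)))
    (quotientHom_surjective _) S h1 h2

variable [Fintype V]

/-- The sum is stable under all generators. Its directness is not needed here; independence comes
from the cocycle algebra. -/
theorem kacMoody_eq_sup (hp : CartanPosDef Γ) :
    Submodule.span ℂ (Set.range (kmH Γ)) ⊔ rootMonomialSpan Γ ℂ (kmE Γ) ⊔
      rootMonomialSpan Γ ℂ (kmF Γ) = ⊤ := by
  set H := Submodule.span ℂ (Set.range (kmH Γ)) with hH
  set N := rootMonomialSpan Γ ℂ (kmE Γ) with hN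
  set N' := rootMonomialSpan Γ ℂ (kmF Γ) with hN'
  have le1 : H ≤ H ⊔ N ⊔ N' := le_sup_of_le_left le_sup_left
  have le2 : N ≤ H ⊔ N ⊔ N' := le_sup_of_le_left le_sup_right
  have le3 : N' ≤ H ⊔ N ⊔ N' := le_sup_right
  have heE : ∀ x y, ⁅kmH Γ x, kmE Γ y⁆ ∈ Submodule.span ℂ {kmE Γ y} := fun x y => by
    rw [lie_kmH_kmE]
    exact zsmul_mem (Submodule.mem_span_singleton_self _) _
  have heF : ∀ x y, ⁅kmH Γ x, kmF Γ y⁆ ∈ Submodule.span ℂ {kmF Γ y} := fun x y => by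
    rw [lie_kmH_kmF]
    exact neg_mem (zsmul_mem (Submodule.mem_span_singleton_self _) _)
  have hEF : ∀ x y, ⁅kmE Γ x, kmF Γ y⁆ ∈ H := fun x y => by
    rcases eq_or_ne x y with rfl | hxy
    · rw [lie_kmE_kmF]
      exact Submodule.subset_span ⟨x, rfl⟩
    · rw [lie_kmE_kmF_of_ne hxy]
      exact zero_mem _
  have hFE : ∀ x y, ⁅kmF Γ x, kmE Γ y⁆ ∈ H := fun x y => by
    rw [← lie_skew]
    exact neg_mem (hEF y x)
  have htors := eq_zero_of_add_self_eq_zero (M := KacMoody Γ) (K := ℂ) two_ne_zero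
  have stable : ∀ (x : KacMoody Γ), (∀ s ∈ H, ⁅x, s⁆ ∈ H ⊔ N ⊔ N') →
      (∀ s ∈ N, ⁅x, s⁆ ∈ H ⊔ N ⊔ N') → (∀ s ∈ N', ⁅x, s⁆ ∈ H ⊔ N ⊔ N') →
      ∀ s ∈ H ⊔ N ⊔ N', ⁅x, s⁆ ∈ H ⊔ N ⊔ N' := fun x h1 h2 h3 s hs => by
    obtain ⟨t, ht, c, hc, rfl⟩ := Submodule.mem_sup.1 hs
    obtain ⟨a, ha, b, hb, rfl⟩ := Submodule.mem_sup.1 ht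
    rw [lie_add, lie_add]
    exact add_mem (add_mem (h1 a ha) (h2 b hb)) (h3 c hc)
  refine kacMoody_eq_top_of_stable _ (fun g => ?_) fun g => ?_
  · rcases g with x | x | x
    · exact le1 (Submodule.subset_span ⟨x, rfl⟩)
    · exact le2 (gen_mem_rootMonomialSpan ℂ x)
    · exact le3 (gen_mem_rootMonomialSpan ℂ x)
  · rcases g with x | x | x
    · change ∀ s ∈ _, ⁅kmH Γ x, s⁆ ∈ _
      have hx : kmH Γ x ∈ H := Submodule.subset_span ⟨x, rfl⟩
      refine stable _ (fun s hs => ?_) (fun s hs => le2 (lie_span_mem_rootMonomialSpan heE hx hs))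
        (fun s hs => le3 (lie_span_mem_rootMonomialSpan heF hx hs))
      have : ⁅kmH Γ x, s⁆ = 0 := by
        induction hs using Submodule.span_induction with
        | mem s hs => obtain ⟨y, rfl⟩ := hs; exact lie_kmH_kmH Γ x y
        | zero => simp
        | add a b _ _ ha hb => rw [lie_add, ha, hb, add_zero]
        | smul c a _ ha => rw [lie_smul, ha, smul_zero]
      rw [this]
      exact zero_mem _
    · change ∀ s ∈ _, ⁅kmE Γ x, s⁆ ∈ _
      refine stable _ (fun s hs => ?_)
        (fun s hs => le2 (lie_mem_rootMonomialSpan hp ℂ (fun _ _ => kmE_comm)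
          (fun _ _ => kmE_serre) htors x hs))
        (fun s hs => sup_le le1 le3 (lie_mem_span_sup_rootMonomialSpan hp (fun _ _ => kmF_comm)
          (fun _ _ => kmF_serre) htors heF hEF x hs))
      rw [← lie_skew]
      exact neg_mem (le2 (lie_span_mem_rootMonomialSpan heE hs (gen_mem_rootMonomialSpan ℂ x)))
    · change ∀ s ∈ _, ⁅kmF Γ x, s⁆ ∈ _
      refine stable _ (fun s hs => ?_)
        (fun s hs => sup_le le1 le2 (lie_mem_span_sup_rootMonomialSpan hp (fun _ _ => kmE_comm)
          (fun _ _ => kmE_serre) htors heE hFE x hs))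
        (fun s hs => le3 (lie_mem_rootMonomialSpan hp ℂ (fun _ _ => kmF_comm)
          (fun _ _ => kmF_serre) htors x hs))
      rw [← lie_skew]
      exact neg_mem (le3 (lie_span_mem_rootMonomialSpan heF hs (gen_mem_rootMonomialSpan ℂ x)))

theorem IsRootMonomial.isMonomial_kmE {n : ℕ} {β : V → ℤ} {m : KacMoody Γ}
    (h : IsRootMonomial Γ (kmE Γ) n β m) : IsMonomial Γ β m := by
  induction h with
  | gen x => exact .E x
  | lie x _ _ ih => exact .lie (.E x) ih

theorem IsRootMonomial.isMonomial_kmF {n : ℕ} {β : V → ℤ} {m : KacMoody Γ}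
    (h : IsRootMonomial Γ (kmF Γ) n β m) : IsMonomial Γ (-β) m := by
  induction h with
  | gen x => exact .F x
  | lie x _ _ ih => rw [neg_add]; exact .lie (.F x) ih

end KacMoody

/-! ### Comparison of the Kac-Moody algebra with the cocycle algebra -/

open scoped Classical in
/-- The sign by which the root vectors of the cocycle algebra are rescaled to a Chevalley basis. -/
noncomputable def rootSign {V : Type*} (β : V → ℤ) : ℂˣ := if 0 ≤ β then 1 else -1

theorem rootSign_eq_or {V : Type*} (β : V → ℤ) : rootSign β = 1 ∨ rootSign β = -1 := by
  unfold rootSign; split_ifs <;> simp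

section Comparison

variable {V : Type v} [DecidableEq V] {Γ : SimpleGraph V} [Fintype V]

open CocycleAlgebra in
theorem CocycleAlgebra.root_comm {β γ : V → ℤ} (hβ : β ∈ normTwo Γ) (hγ : γ ∈ normTwo Γ)
    (h : pairing Γ β γ = 0) : ⁅root Γ β, root Γ γ⁆ = 0 :=
  root_bracket_eq_zero hβ hγ h.ge

open CocycleAlgebra in
theorem CocycleAlgebra.root_serre {β γ : V → ℤ} (hβ : β ∈ normTwo Γ) (hγ : γ ∈ normTwo Γ)
    (h : pairing Γ β γ = -1) : ⁅root Γ β, ⁅root Γ β, root Γ γ⁆⁆ = 0 := by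
  have hm := (add_mem_normTwo_iff hβ hγ).2 h
  rw [root_bracket_root hβ hγ (ne_zero_of_mem_normTwo hm), bracket_smul,
    root_bracket_eq_zero hβ hm, smul_zero]
  rw [pairing_add_right, h, show pairing Γ β β = 2 from hβ]
  decide

theorem pairing_simpleRoot_of_adj {x y : V} (h : Γ.Adj x y) :
    pairing Γ (simpleRoot x) (simpleRoot y) = -1 := by
  rw [pairing_simpleRoot_simpleRoot, cartanMatrix_of_adj h]

theorem pairing_simpleRoot_of_not_adj {x y : V} (hxy : x ≠ y) (h : ¬ Γ.Adj x y) :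
    pairing Γ (simpleRoot x) (simpleRoot y) = 0 := by
  rw [pairing_simpleRoot_simpleRoot, cartanMatrix_of_not_adj hxy h]

theorem not_nonneg_neg {β : V → ℤ} (h : β ∈ normTwo Γ) (h1 : 0 ≤ β) (h2 : 0 ≤ -β) : False :=
  ne_zero_of_mem_normTwo h (le_antisymm (neg_nonneg.1 h2) h1)

section

open CocycleAlgebra

/-- The root vector of `β` in the cocycle algebra, rescaled by its sign. -/
noncomputable def signedRoot (Γ : SimpleGraph V) (β : V → ℤ) : CocycleAlgebra Γ :=
  (rootSign β : ℂ) • root Γ β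

theorem eq_signedRoot_or {β : V → ℤ} {a : CocycleAlgebra Γ} (h : a = root Γ β ∨ a = -root Γ β) :
    a = signedRoot Γ β ∨ a = -signedRoot Γ β := by
  rcases rootSign_eq_or β with h' | h' <;> simpa [signedRoot, h', or_comm] using h

theorem signedRoot_ne_zero {β : V → ℤ} (hβ : β ∈ normTwo Γ) : signedRoot Γ β ≠ 0 := by
  rw [signedRoot, root_of_mem hβ]
  exact smul_ne_zero (Units.ne_zero _) ((basis Γ).ne_zero _)

variable (Γ) in
/-- The weights of the standard basis. -/
def CocycleAlgebra.basisWeight : V ⊕ normTwo Γ → V → ℤ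
  | .inl _ => 0
  | .inr γ => γ

end

variable [hp : Fact (CartanPosDef Γ)]

variable (Γ) in
/-- The images of the generators of the Kac-Moody algebra in the cocycle algebra. -/
noncomputable def generatorImage : CartanMatrix.Generators V → CocycleAlgebra Γ
  | .H x => CocycleAlgebra.cartan Γ (simpleRoot x)
  | .E x => CocycleAlgebra.root Γ (simpleRoot x)
  | .F x => -CocycleAlgebra.root Γ (-simpleRoot x)

open CocycleAlgebra in
-- For distinct vertices α_x and -α_y pair nonnegatively, so E_x and F_y commute. The Serre
-- relations hold because α_x pairs to 1 with α_x + α_y for adjacent vertices.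
theorem lift_generatorImage_eq_zero {z : FreeLieAlgebra ℂ (CartanMatrix.Generators V)}
    (hz : z ∈ CartanMatrix.Relations.toSet ℂ (cartanMatrix Γ)) :
    FreeLieAlgebra.lift ℂ (generatorImage Γ) z = 0 := by
  have hs := simpleRoot_mem_normTwo Γ
  have hs' : ∀ x, -simpleRoot x ∈ normTwo Γ := fun x => neg_mem_normTwo (hs x)
  obtain ((((⟨⟨x, y⟩, rfl⟩ | ⟨⟨x, y⟩, rfl⟩) | ⟨⟨x, y⟩, rfl⟩) | ⟨⟨x, y⟩, rfl⟩) | ⟨⟨x, y⟩, rfl⟩) |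
    ⟨⟨x, y⟩, rfl⟩ := hz
  · simp [CartanMatrix.Relations.HH, generatorImage, cartan_bracket_cartan]
  · rcases eq_or_ne x y with rfl | hxy
    · simp [CartanMatrix.Relations.EF, generatorImage, root_bracket_root_neg (hs x)]
    · simp only [CartanMatrix.Relations.EF, Function.uncurry, if_neg hxy, Function.comp_apply,
        LieHom.map_lie, FreeLieAlgebra.lift_of_apply, generatorImage, lie_neg, neg_eq_zero]
      refine root_bracket_eq_zero (hs x) (hs' y) ?_
      rw [pairing_neg_right, pairing_simpleRoot_simpleRoot, cartanMatrix, if_neg hxy]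
      split_ifs <;> decide
  · simp only [CartanMatrix.Relations.HE, Function.uncurry, Function.comp_apply, map_sub, map_zsmul,
      LieHom.map_lie, FreeLieAlgebra.lift_of_apply, generatorImage, cartan_bracket_root,
      pairing_simpleRoot_simpleRoot, Int.cast_smul_eq_zsmul, sub_self]
  · simp only [CartanMatrix.Relations.HF, Function.uncurry, Function.comp_apply, map_add, map_zsmul,
      LieHom.map_lie, FreeLieAlgebra.lift_of_apply, generatorImage, cartan_bracket_root, lie_neg,
      pairing_neg_right, pairing_simpleRoot_simpleRoot, Int.cast_smul_eq_zsmul, smul_neg, neg_smul,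
      Int.cast_neg, neg_neg, add_neg_cancel]
  · rcases eq_or_ne x y with rfl | hxy
    · simp [CartanMatrix.Relations.adE]
    by_cases hA : Γ.Adj x y
    · simpa [CartanMatrix.Relations.adE, cartanMatrix_of_adj hA, generatorImage] using
        root_serre (hs x) (hs y) (pairing_simpleRoot_of_adj hA)
    · simpa [CartanMatrix.Relations.adE, cartanMatrix_of_not_adj hxy hA, generatorImage] using
        root_comm (hs x) (hs y) (pairing_simpleRoot_of_not_adj hxy hA)
  · rcases eq_or_ne x y with rfl | hxy
    · simp [CartanMatrix.Relations.adF]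
    by_cases hA : Γ.Adj x y
    · simpa [CartanMatrix.Relations.adF, cartanMatrix_of_adj hA, generatorImage, -lie_skew] using
        root_serre (hs' x) (hs' y) (by
          rw [pairing_neg_left, pairing_neg_right, neg_neg, pairing_simpleRoot_of_adj hA])
    · simpa [CartanMatrix.Relations.adF, cartanMatrix_of_not_adj hxy hA, generatorImage] using
        root_comm (hs' x) (hs' y) (by
          rw [pairing_neg_left, pairing_neg_right, neg_neg, pairing_simpleRoot_of_not_adj hxy hA])

variable (Γ) in
theorem exists_comparison : ∃ π : KacMoody Γ →ₗ⁅ℂ⁆ CocycleAlgebra Γ,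
    ∀ g, π (kmGen Γ g) = generatorImage Γ g := by
  obtain ⟨π, hπ⟩ := exists_lift_quotient rfl (FreeLieAlgebra.lift ℂ (generatorImage Γ))
    fun z hz => lift_generatorImage_eq_zero hz
  exact ⟨π, fun g => (hπ _).trans (FreeLieAlgebra.lift_of_apply _ _)⟩

variable (Γ) in
/-- The homomorphism from the Kac-Moody algebra to the cocycle algebra. -/
noncomputable def comparison : KacMoody Γ →ₗ⁅ℂ⁆ CocycleAlgebra Γ := (exists_comparison Γ).choose

open CocycleAlgebra

theorem comparison_kmE (x : V) : comparison Γ (kmE Γ x) = root Γ (simpleRoot x) :=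
  (exists_comparison Γ).choose_spec (.E x)

theorem comparison_kmF (x : V) : comparison Γ (kmF Γ x) = -root Γ (-simpleRoot x) :=
  (exists_comparison Γ).choose_spec (.F x)

theorem comparison_kmH (x : V) : comparison Γ (kmH Γ x) = cartan Γ (simpleRoot x) :=
  (exists_comparison Γ).choose_spec (.H x)

theorem comparison_corootElt (β : V → ℤ) : comparison Γ (corootElt Γ β) = cartan Γ β := by
  simp only [corootElt, map_sum, map_zsmul, comparison_kmH, cartan_simpleRoot]
  simp only [cartan, Int.cast_smul_eq_zsmul]

/-- A root monomial in root vectors is a root vector up to sign. -/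
theorem IsRootMonomial.eq_root_or {σ : (V → ℤ) →+ (V → ℤ)}
    (hσ : ∀ β γ, pairing Γ (σ β) (σ γ) = pairing Γ β γ) {e : V → CocycleAlgebra Γ}
    (he : ∀ x, e x = root Γ (σ (simpleRoot x)) ∨ e x = -root Γ (σ (simpleRoot x))) {n : ℕ}
    {β : V → ℤ} {m : CocycleAlgebra Γ} (h : IsRootMonomial Γ e n β m) :
    m = root Γ (σ β) ∨ m = -root Γ (σ β) := by
  -- The isometry σ is the identity for the `E_x` and the negation for the `F_x`, so one induction
  -- serves both.
  have hmem : ∀ β ∈ normTwo Γ, σ β ∈ normTwo Γ := fun β hβ => (hσ β β).trans hβ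
  induction h with
  | gen x => exact he x
  | @lie x n β m h hx ih =>
    have h1 := hmem _ (simpleRoot_mem_normTwo Γ x)
    have h2 := hmem _ h.mem_normTwo
    have h3 : ⁅root Γ (σ (simpleRoot x)), root Γ (σ β)⁆ = root Γ (σ (simpleRoot x + β)) ∨
        ⁅root Γ (σ (simpleRoot x)), root Γ (σ β)⁆ = -root Γ (σ (simpleRoot x + β)) := by
      rw [map_add, root_bracket_root h1 h2 (ne_zero_of_mem_normTwo
        ((add_mem_normTwo_iff h1 h2).2 ((hσ _ _).trans hx)))]
      rcases sgn_eq_or Γ (σ (simpleRoot x)) (σ β) with h | h <;> simp [h]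
    rcases he x with h4 | h4 <;> rcases ih with h5 | h5 <;> rcases h3 with h6 | h6 <;>
      simp [h4, h5, h6]

theorem IsRootMonomial.comparison_kmE_eq_or {n : ℕ} {β : V → ℤ} {m : KacMoody Γ}
    (h : IsRootMonomial Γ (kmE Γ) n β m) :
    comparison Γ m = root Γ β ∨ comparison Γ m = -root Γ β :=
  (h.map (comparison Γ) (LieHom.map_lie _) fun _ => rfl).eq_root_or (σ := AddMonoidHom.id _)
    (fun _ _ => rfl) fun x => Or.inl (comparison_kmE x)

theorem IsRootMonomial.comparison_kmF_eq_or {n : ℕ} {β : V → ℤ} {m : KacMoody Γ}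
    (h : IsRootMonomial Γ (kmF Γ) n β m) :
    comparison Γ m = root Γ (-β) ∨ comparison Γ m = -root Γ (-β) :=
  (h.map (comparison Γ) (LieHom.map_lie _) fun _ => rfl).eq_root_or (σ := -AddMonoidHom.id _)
    (fun β γ => by simp [pairing_neg_left, pairing_neg_right]) fun x => Or.inr (comparison_kmF x)

/-- Exactly one of β and -β is positive; this sign turns [root β, root (-β)] = -cartan β into the
normalization of a Chevalley basis. -/
theorem rootSign_mul_neg {β : V → ℤ} (hβ : β ∈ normTwo Γ) :
    rootSign β * rootSign (-β) = -1 := by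
  have h0 := ne_zero_of_mem_normTwo hβ
  rcases hp.out.nonneg_or_nonpos hβ with h | h
  · rw [rootSign, rootSign, if_pos h, if_neg, one_mul]
    exact fun h' => h0 (le_antisymm (neg_nonneg.1 h') h)
  · rw [rootSign, rootSign, if_pos h, if_neg, mul_one]
    exact fun h' => h0 (le_antisymm (neg_nonneg.1 h) h')

/-- The last clause records that the vector is a root monomial up to sign, so that uniqueness puts
every root monomial of that weight on its line. -/
theorem exists_rootVector {β : V → ℤ} (hβ : β ∈ normTwo Γ) : ∃ v ∈ weightSpace Γ β,
    comparison Γ v = signedRoot Γ β ∧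
    ((∃ n, IsRootMonomial Γ (kmE Γ) n β v ∨ IsRootMonomial Γ (kmE Γ) n β (-v)) ∨
     (∃ n, IsRootMonomial Γ (kmF Γ) n (-β) v ∨ IsRootMonomial Γ (kmF Γ) n (-β) (-v))) := by
  rcases hp.out.nonneg_or_nonpos hβ with h0 | h0
  · obtain ⟨n, m, hm⟩ := IsRootMonomial.exists_of_nonneg (kmE Γ) hβ h0 hp.out
    have hw : m ∈ weightSpace Γ β := Submodule.subset_span hm.isMonomial_kmE
    rcases eq_signedRoot_or hm.comparison_kmE_eq_or with h | h
    · exact ⟨m, hw, h, Or.inl ⟨n, Or.inl hm⟩⟩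
    · exact ⟨-m, neg_mem hw, by rw [map_neg, h, neg_neg], Or.inl ⟨n, Or.inr (by rwa [neg_neg])⟩⟩
  · obtain ⟨n, m, hm⟩ := IsRootMonomial.exists_of_nonneg (kmF Γ) (neg_mem_normTwo hβ) h0 hp.out
    have hw : m ∈ weightSpace Γ β := by
      have h1 := hm.isMonomial_kmF
      rw [neg_neg] at h1
      exact Submodule.subset_span h1
    have h2 := hm.comparison_kmF_eq_or
    rw [neg_neg] at h2
    rcases eq_signedRoot_or h2 with h | h
    · exact ⟨m, hw, h, Or.inr ⟨n, Or.inl hm⟩⟩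
    · exact ⟨-m, neg_mem hw, by rw [map_neg, h, neg_neg], Or.inr ⟨n, Or.inr (by rwa [neg_neg])⟩⟩

open scoped Classical in
variable (Γ) in
/-- A root vector of the Kac-Moody algebra that the comparison sends to the rescaled root vector
of the cocycle algebra. -/
noncomputable def rootVector (β : V → ℤ) : KacMoody Γ :=
  if h : β ∈ normTwo Γ then (exists_rootVector h).choose else 0

theorem rootVector_mem_weightSpace (β : V → ℤ) : rootVector Γ β ∈ weightSpace Γ β := by
  unfold rootVector
  split_ifs with h
  · exact (exists_rootVector h).choose_spec.1
  · exact zero_mem _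

theorem comparison_rootVector (β : V → ℤ) : comparison Γ (rootVector Γ β) = signedRoot Γ β := by
  unfold rootVector
  split_ifs with h
  · exact (exists_rootVector h).choose_spec.2.1
  · rw [map_zero, signedRoot, root_of_not_mem h, smul_zero]

theorem exists_isRootMonomial_rootVector {β : V → ℤ} (h : β ∈ normTwo Γ) :
    (∃ n, IsRootMonomial Γ (kmE Γ) n β (rootVector Γ β) ∨
      IsRootMonomial Γ (kmE Γ) n β (-rootVector Γ β)) ∨
    (∃ n, IsRootMonomial Γ (kmF Γ) n (-β) (rootVector Γ β) ∨
      IsRootMonomial Γ (kmF Γ) n (-β) (-rootVector Γ β)) := by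
  have := (exists_rootVector h).choose_spec.2.2
  rwa [rootVector, dif_pos h]

theorem mem_span_rootVector_of_kmE {n : ℕ} {β : V → ℤ} {m : KacMoody Γ}
    (h : IsRootMonomial Γ (kmE Γ) n β m) : m ∈ Submodule.span ℂ {rootVector Γ β} := by
  have key := fun {k} {m'} (h' : IsRootMonomial Γ (kmE Γ) k β m') =>
    h'.eq_or_eq_neg (fun _ _ => kmE_comm) hp.out h
  have hv := Submodule.mem_span_singleton_self (R := ℂ) (rootVector Γ β)
  rcases exists_isRootMonomial_rootVector h.mem_normTwo with ⟨k, h' | h'⟩ | ⟨k, h' | h'⟩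
  · rcases key h' with rfl | rfl
    exacts [hv, neg_mem hv]
  · rcases key h' with rfl | rfl
    exacts [neg_mem hv, neg_mem (neg_mem hv)]
  · exact (not_nonneg_neg h.mem_normTwo h.nonneg h'.nonneg).elim
  · exact (not_nonneg_neg h.mem_normTwo h.nonneg h'.nonneg).elim

theorem mem_span_rootVector_of_kmF {n : ℕ} {β : V → ℤ} {m : KacMoody Γ}
    (h : IsRootMonomial Γ (kmF Γ) n β m) : m ∈ Submodule.span ℂ {rootVector Γ (-β)} := by
  have hb := neg_mem_normTwo h.mem_normTwo
  have key := fun {k} {m'} (h' : IsRootMonomial Γ (kmF Γ) k (- -β) m') =>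
    h'.eq_or_eq_neg (fun _ _ => kmF_comm) hp.out (h.cast rfl (neg_neg β).symm rfl)
  have hv := Submodule.mem_span_singleton_self (R := ℂ) (rootVector Γ (-β))
  rcases exists_isRootMonomial_rootVector hb with ⟨k, h' | h'⟩ | ⟨k, h' | h'⟩
  · exact (not_nonneg_neg h.mem_normTwo h.nonneg h'.nonneg).elim
  · exact (not_nonneg_neg h.mem_normTwo h.nonneg h'.nonneg).elim
  · rcases key h' with rfl | rfl
    exacts [hv, neg_mem hv]
  · rcases key h' with rfl | rfl
    exacts [neg_mem hv, neg_mem (neg_mem hv)]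

/-- The index set is left open because this is used first for the vectors of norm two, to prove
injectivity, and only afterwards for the roots. -/
theorem span_kmH_rootVector {S : Set (V → ℤ)} (hS : normTwo Γ ⊆ S) :
    Submodule.span ℂ (Set.range (Sum.elim (kmH Γ) fun β : S => rootVector Γ β)) = ⊤ := by
  have hmem : ∀ β ∈ normTwo Γ, Submodule.span ℂ {rootVector Γ β} ≤
      Submodule.span ℂ (Set.range (Sum.elim (kmH Γ) fun β : S => rootVector Γ β)) := fun β hβ =>
    Submodule.span_mono (Set.singleton_subset_iff.2 ⟨Sum.inr ⟨β, hS hβ⟩, rfl⟩)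
  rw [eq_top_iff, ← kacMoody_eq_sup hp.out]
  refine sup_le (sup_le (Submodule.span_mono ?_) (Submodule.span_le.2 ?_))
    (Submodule.span_le.2 ?_)
  · rintro _ ⟨x, rfl⟩
    exact ⟨Sum.inl x, rfl⟩
  · rintro m ⟨n, β, hm⟩
    exact hmem β hm.mem_normTwo (mem_span_rootVector_of_kmE hm)
  · rintro m ⟨n, β, hm⟩
    exact hmem _ (neg_mem_normTwo hm.mem_normTwo) (mem_span_rootVector_of_kmF hm)

theorem linearIndependent_comparison {S : Set (V → ℤ)} (hS : S ⊆ normTwo Γ) :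
    LinearIndependent ℂ
      (comparison Γ ∘ Sum.elim (kmH Γ) fun β : S => rootVector Γ β) := by
  have h1 := ((basis Γ).linearIndependent.units_smul
    (Sum.elim (fun _ => 1) fun β => rootSign (β : V → ℤ))).comp
    (Sum.map id (Set.inclusion hS)) (Function.injective_id.sumMap (Set.inclusion_injective hS))
  convert h1 using 1
  funext i
  rcases i with x | β
  · simp [comparison_kmH, cartan_simpleRoot]
  · simp [comparison_rootVector, signedRoot, root_of_mem (hS β.2), Units.smul_def, Set.inclusion]

theorem linearIndependent_kmH_rootVector {S : Set (V → ℤ)} (hS : S ⊆ normTwo Γ) :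
    LinearIndependent ℂ (Sum.elim (kmH Γ) fun β : S => rootVector Γ β) :=
  LinearIndependent.of_comp (comparison Γ : KacMoody Γ →ₗ[ℂ] CocycleAlgebra Γ)
    (linearIndependent_comparison hS)

theorem injective_of_linearIndependent_comp {ι R M M' : Type*} [CommRing R] [AddCommGroup M]
    [Module R M] [AddCommGroup M'] [Module R M'] (f : M →ₗ[R] M') (v : ι → M)
    (hv : Submodule.span R (Set.range v) = ⊤) (h : LinearIndependent R (f ∘ v)) :
    Function.Injective f := by
  rw [← LinearMap.ker_eq_bot, LinearMap.ker_eq_bot']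
  intro z hz
  obtain ⟨c, rfl⟩ := Finsupp.mem_span_range_iff_exists_finsupp.1
    (hv.symm ▸ Submodule.mem_top : z ∈ Submodule.span R (Set.range v))
  have hc : c = 0 := by
    refine linearIndependent_iff.1 h c ?_
    rw [← hz, Finsupp.linearCombination_apply, Finsupp.sum, Finsupp.sum, map_sum]
    simp
  simp [hc]

variable (Γ) in
theorem comparison_injective : Function.Injective (comparison Γ) :=
  injective_of_linearIndependent_comp (comparison Γ : KacMoody Γ →ₗ[ℂ] CocycleAlgebra Γ) _
    (span_kmH_rootVector subset_rfl) (linearIndependent_comparison subset_rfl)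

/-- The eigenvalues of the generators `H_x` on the standard basis of the cocycle algebra. -/
theorem CocycleAlgebra.repr_cartan_bracket (β : V → ℤ) (a : CocycleAlgebra Γ)
    (i : V ⊕ normTwo Γ) : (basis Γ).repr ⁅cartan Γ β, a⁆ i
      = (pairing Γ β (basisWeight Γ i) : ℂ) * (basis Γ).repr a i := by
  induction a using basis_induction with
  | hzero => simp
  | hadd a b ha hb => rw [lie_add, map_add, map_add, Finsupp.add_apply, Finsupp.add_apply, ha, hb,
      mul_add]
  | hsmul r a ha => rw [lie_smul, map_smul, map_smul, Finsupp.smul_apply, Finsupp.smul_apply, ha,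
      smul_eq_mul, smul_eq_mul, mul_left_comm]
  | hcartan γ =>
    rw [cartan_bracket_cartan, map_zero, Finsupp.zero_apply]
    rcases i with x | δ
    · simp [basisWeight, pairing_zero_right]
    · simp [cartan]
  | hroot γ hγ =>
    rw [cartan_bracket_root, map_smul, Finsupp.smul_apply, smul_eq_mul, root_of_mem hγ,
      Module.Basis.repr_self]
    rcases eq_or_ne (Sum.inr ⟨γ, hγ⟩) i with rfl | h
    · rfl
    · rw [Finsupp.single_eq_of_ne h.symm, mul_zero, mul_zero]

variable (Γ) in
/-- The roots are the vectors of norm two. -/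
theorem roots_eq_normTwo : roots Γ = normTwo Γ := by
  ext β
  refine ⟨fun ⟨h0, h⟩ => ?_, fun hβ => ⟨ne_zero_of_mem_normTwo hβ, fun h => ?_⟩⟩
  · obtain ⟨z, hz, hz0⟩ := Submodule.exists_mem_ne_zero_of_ne_bot h
    have h1 : comparison Γ z ≠ 0 := fun h' => hz0 (comparison_injective Γ (by rw [h', map_zero]))
    -- Comparing eigenvalues of all `H_x` at a nonzero coordinate of the image shows that β and the
    -- weight of that basis vector pair equally with every simple root; nondegeneracy identifies
    -- them.
    obtain ⟨i, hi⟩ := Finsupp.ne_iff.1 ((basis Γ).repr.map_ne_zero_iff.2 h1)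
    have h2 : β = basisWeight Γ i := by
      refine hp.out.eq_of_forall_pairing fun x => ?_
      have h3 := congrArg (fun z => (basis Γ).repr (comparison Γ z) i) (lie_kmH_of_mem Γ x hz)
      simp only [LieHom.map_lie, comparison_kmH, repr_cartan_bracket, map_zsmul,
        Finsupp.smul_apply, zsmul_eq_mul] at h3
      rw [← pairing_simpleRoot_left] at h3
      exact_mod_cast (mul_right_cancel₀ hi h3).symm
    rcases i with x | γ
    · exact (h0 h2).elim
    · rw [h2]; exact γ.2
  · have h1 := rootVector_mem_weightSpace (Γ := Γ) β
    rw [h, Submodule.mem_bot] at h1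
    refine signedRoot_ne_zero hβ ?_
    rw [← comparison_rootVector, h1, map_zero]

theorem mem_roots_iff {β : V → ℤ} : β ∈ roots Γ ↔ β ∈ normTwo Γ := by rw [roots_eq_normTwo]

theorem simpleRoot_mem_roots (x : V) : simpleRoot x ∈ roots Γ :=
  mem_roots_iff.2 (simpleRoot_mem_normTwo Γ x)

-- All identities are checked after the injective map to the cocycle algebra.
variable (Γ) in
theorem nonempty_chevalleyBasis : Nonempty (ChevalleyBasis Γ) := by
  have hR := roots_eq_normTwo Γ
  have hinj := comparison_injective Γ
  refine ⟨{
    rootVec := fun β => rootVector Γ β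
    rootVec_mem := fun β => rootVector_mem_weightSpace _
    rootVec_simple := fun x _ => hinj ?_
    rootVec_neg_simple := fun x _ => hinj ?_
    linearIndependent := linearIndependent_kmH_rootVector hR.subset
    span_eq_top := span_kmH_rootVector hR.superset
    lie_neg := fun β γ h => hinj ?_
    lie_add := fun β γ δ h => ⟨0, ?_, ?_, ?_⟩ }⟩
  · rw [comparison_rootVector, comparison_kmE, signedRoot, rootSign,
      if_pos (simpleRoot_nonneg x), Units.val_one, one_smul]
  · rw [comparison_rootVector, comparison_kmF, signedRoot, rootSign, if_neg fun h =>
      not_nonneg_neg (simpleRoot_mem_normTwo Γ x) (simpleRoot_nonneg x) h, Units.val_neg,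
      Units.val_one, neg_one_smul]
  · have hβ : (β : V → ℤ) ∈ normTwo Γ := hR ▸ β.2
    rw [LieHom.map_lie, comparison_rootVector, comparison_rootVector, comparison_corootElt, h,
      signedRoot, signedRoot, smul_lie, lie_smul, root_bracket_root_neg hβ, smul_smul,
      ← Units.val_mul, rootSign_mul_neg hβ]
    simp
  all_goals
    have hβ : (β : V → ℤ) ∈ normTwo Γ := hR ▸ β.2
    have hγ : (γ : V → ℤ) ∈ normTwo Γ := hR ▸ γ.2
    have hδ : (δ : V → ℤ) ∈ normTwo Γ := hR ▸ δ.2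
    rw [h] at hδ
    have hβγ := (add_mem_normTwo_iff hβ hγ).1 hδ
  · intro j hj
    obtain rfl : j = 0 := by omega
    simp
  -- The root string has p = 0: γ - β would need pairing 1, while β + γ being a root means -1.
  · intro hm
    have h1 : (γ : V → ℤ) - β ∈ normTwo Γ := hR ▸ (by simpa using hm)
    rw [sub_mem_normTwo_iff hγ hβ, pairing_comm, hβγ] at h1
    omega
  · have h1 : comparison Γ ⁅rootVector Γ β, rootVector Γ γ⁆
        = ((rootSign (β : V → ℤ) : ℂ) * (rootSign (γ : V → ℤ) : ℂ) * sgn Γ β γ) • root Γ δ := by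
      rw [LieHom.map_lie, comparison_rootVector, comparison_rootVector, signedRoot, signedRoot,
        smul_lie, lie_smul, root_bracket_root hβ hγ (ne_zero_of_mem_normTwo hδ), smul_smul,
        smul_smul, h]
    have h2 : comparison Γ ⁅rootVector Γ β, rootVector Γ γ⁆ = signedRoot Γ δ ∨
        comparison Γ ⁅rootVector Γ β, rootVector Γ γ⁆ = -signedRoot Γ δ := by
      refine eq_signedRoot_or ?_
      rw [h1]
      rcases rootSign_eq_or (β : V → ℤ) with a | a <;> rcases rootSign_eq_or (γ : V → ℤ) with b | b <;>
        rcases sgn_eq_or Γ β γ with c | c <;> simp [a, b, c]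
    rw [← comparison_rootVector, ← map_neg] at h2
    simpa using h2.imp (@hinj _ _) (@hinj _ _)

end Comparison

/-! ### The sandwich algebra -/

section SandwichAlgebra

variable {V : Type v} {Γ : SimpleGraph V} (K : Type u) [Field K]

theorem sandwichGen_comm {x y : V} (h : ¬ Γ.Adj x y) :
    ⁅sandwichGen K Γ x, sandwichGen K Γ y⁆ = 0 := by
  have h1 : ⁅graphGen K Γ x, graphGen K Γ y⁆ = 0 :=
    LieSubmodule.Quotient.mk_eq_zero'.2 (LieSubmodule.subset_lieSpan ⟨x, y, h, rfl⟩)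
  exact congrArg (quotientHom (extremalIdeal K Γ 0)) h1

theorem sandwichGen_serre (x y : V) :
    ⁅sandwichGen K Γ x, ⁅sandwichGen K Γ x, sandwichGen K Γ y⁆⁆ = 0 :=
  LieSubmodule.Quotient.mk_eq_zero'.2
    (LieSubmodule.subset_lieSpan ⟨x, graphGen K Γ y, by simp⟩)

variable (Γ) in
/-- The quotient map from the free Lie algebra to the sandwich algebra. -/
noncomputable def sandwichHom : FreeLieAlgebra K V →ₗ⁅K⁆ SandwichAlgebra K Γ :=
  (quotientHom (extremalIdeal K Γ 0)).comp (quotientHom (commIdeal K Γ))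

variable (Γ) in
theorem sandwichHom_surjective : Function.Surjective (sandwichHom Γ K) :=
  (quotientHom_surjective _).comp (quotientHom_surjective _)

theorem sandwichAlgebra_hom_ext {L : Type*} [LieRing L] [LieAlgebra K L]
    {φ ψ : SandwichAlgebra K Γ →ₗ⁅K⁆ L}
    (h : ∀ x, φ (sandwichGen K Γ x) = ψ (sandwichGen K Γ x)) : φ = ψ := by
  have h1 : φ.comp (sandwichHom Γ K) = ψ.comp (sandwichHom Γ K) := FreeLieAlgebra.hom_ext h
  ext z
  obtain ⟨w, rfl⟩ := sandwichHom_surjective Γ K z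
  exact LieHom.congr_fun h1 w

/-- The universal property of the sandwich algebra. -/
theorem exists_sandwichAlgebra_hom {L : Type*} [LieRing L] [LieAlgebra K L] (e : V → L)
    (hcomm : ∀ x y, ¬ Γ.Adj x y → ⁅e x, e y⁆ = 0) (hsand : ∀ (x : V) (z : L), ⁅e x, ⁅e x, z⁆⁆ = 0) :
    ∃ φ : SandwichAlgebra K Γ →ₗ⁅K⁆ L, ∀ x, φ (sandwichGen K Γ x) = e x := by
  obtain ⟨f, hf⟩ := exists_lift_quotient (I := commIdeal K Γ) rfl (FreeLieAlgebra.lift K e) (by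
    rintro _ ⟨x, y, h, rfl⟩
    simp [hcomm x y h])
  have hf' : ∀ x, f (graphGen K Γ x) = e x := fun x =>
    (hf _).trans (FreeLieAlgebra.lift_of_apply _ _)
  obtain ⟨φ, hφ⟩ := exists_lift_quotient (I := extremalIdeal K Γ 0) rfl f (by
    rintro _ ⟨x, y, rfl⟩
    rw [Pi.zero_apply, LinearMap.zero_apply, zero_smul, sub_zero, LieHom.map_lie,
      LieHom.map_lie, hf']
    exact hsand x _)
  exact ⟨φ, fun x => (hφ _).trans (hf' x)⟩

/-- The Serre relations are the sandwich relations applied to generators, so the upper bound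
applies. -/
theorem rootMonomialSpan_sandwichGen [DecidableEq V] [Fintype V] (hp : CartanPosDef Γ)
    (hK : (2 : K) ≠ 0) : rootMonomialSpan Γ K (sandwichGen K Γ) = ⊤ :=
  eq_top_of_stable (sandwichHom Γ K) (sandwichHom_surjective Γ K) _
    (gen_mem_rootMonomialSpan K) fun x _ hs => lie_mem_rootMonomialSpan hp K
      (fun _ _ => sandwichGen_comm K) (fun x y _ => sandwichGen_serre K x y)
      (eq_zero_of_add_self_eq_zero hK) x hs

end SandwichAlgebra

/-! ### Lie algebras with Chevalley root vectors -/

section RootVectors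

variable {V : Type v} [DecidableEq V] {Γ : SimpleGraph V}

/-- The span of the root vectors of positive roots. -/
def posSpan (K : Type*) [CommRing K] {L : Type*} [LieRing L] [LieAlgebra K L] (r : roots Γ → L) :
    Submodule K L :=
  Submodule.span K {v | ∃ β : roots Γ, (β : V → ℤ) ∈ posRoots Γ ∧ v = r β}

theorem mem_posSpan {K : Type*} [CommRing K] {L : Type*} [LieRing L] [LieAlgebra K L]
    {r : roots Γ → L} {β : roots Γ} (h : 0 ≤ (β : V → ℤ)) : r β ∈ posSpan K r :=
  Submodule.subset_span ⟨β, ⟨β.2, h⟩, rfl⟩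

variable [Fintype V]

/-- The vectors `r β` multiply like the root vectors of a simply laced Chevalley algebra, and the
`e x` are the ones of the simple roots. -/
structure IsRootVectorFamily {L : Type*} [LieRing L] (r : roots Γ → L) (e : V → L) : Prop where
  simple : ∀ (x : V) (h : simpleRoot x ∈ roots Γ), r ⟨simpleRoot x, h⟩ = e x
  lie_eq_zero : ∀ β γ : roots Γ, 0 ≤ pairing Γ β γ → ⁅r β, r γ⁆ = 0
  lie_eq_or : ∀ β γ δ : roots Γ, (δ : V → ℤ) = β + γ → ⁅r β, r γ⁆ = r δ ∨ ⁅r β, r γ⁆ = -r δ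

theorem IsRootMonomial.mem_lieSpan (K : Type*) [CommRing K] {L : Type*} [LieRing L]
    [LieAlgebra K L] {e : V → L} {n : ℕ} {β : V → ℤ} {m : L} (h : IsRootMonomial Γ e n β m) :
    m ∈ LieSubalgebra.lieSpan K L (Set.range e) := by
  have hE : ∀ x, e x ∈ LieSubalgebra.lieSpan K L (Set.range e) := fun x =>
    LieSubalgebra.subset_lieSpan ⟨x, rfl⟩
  induction h with
  | gen x => exact hE x
  | lie x _ _ ih => exact LieSubalgebra.lie_mem _ (hE x) ih

variable [hp : Fact (CartanPosDef Γ)]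

theorem mem_normTwo (β : roots Γ) : (β : V → ℤ) ∈ normTwo Γ := mem_roots_iff.1 β.2

/-- The inner product of two positive roots is `-1` if it is negative. -/
theorem pairing_eq_neg_one_of_neg {β γ : roots Γ} (hβ : 0 ≤ (β : V → ℤ)) (hγ : 0 ≤ (γ : V → ℤ))
    (h : ¬ 0 ≤ pairing Γ β γ) : pairing Γ β γ = -1 := by
  have h2 := hp.out.neg_two_le_pairing (mem_normTwo β) (mem_normTwo γ)
  have h3 : pairing Γ β γ ≠ -2 := fun h3 => by
    rw [hp.out.eq_neg_of_pairing_eq_neg_two (mem_normTwo β) (mem_normTwo γ) h3] at hβ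
    exact not_nonneg_neg (mem_normTwo γ) hγ hβ
  omega

theorem add_mem_roots {β γ : roots Γ} (h : pairing Γ β γ = -1) : (β : V → ℤ) + γ ∈ roots Γ :=
  mem_roots_iff.2 ((add_mem_normTwo_iff (mem_normTwo β) (mem_normTwo γ)).2 h)

namespace IsRootVectorFamily

variable {K : Type*} [Field K] {L : Type*} [LieRing L] [LieAlgebra K L] {r : roots Γ → L}
  {e : V → L} (hr : IsRootVectorFamily r e)

include hr

theorem lie_mem_posSpan {a b : L} (ha : a ∈ posSpan K r) (hb : b ∈ posSpan K r) :
    ⁅a, b⁆ ∈ posSpan K r := by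
  induction ha using Submodule.span_induction with
  | zero => rw [zero_lie]; exact zero_mem _
  | add a a' _ _ h h' => rw [add_lie]; exact add_mem h h'
  | smul c a _ h => rw [smul_lie]; exact Submodule.smul_mem _ c h
  | mem a ha =>
    obtain ⟨β, hβ, rfl⟩ := ha
    induction hb using Submodule.span_induction with
    | zero => rw [lie_zero]; exact zero_mem _
    | add b b' _ _ h h' => rw [lie_add]; exact add_mem h h'
    | smul c b _ h => rw [lie_smul]; exact Submodule.smul_mem _ c h
    | mem b hb =>
      obtain ⟨γ, hγ, rfl⟩ := hb
      by_cases h : 0 ≤ pairing Γ β γ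
      · rw [hr.lie_eq_zero _ _ h]
        exact zero_mem _
      have h4 := add_mem_roots (pairing_eq_neg_one_of_neg hβ.2 hγ.2 h)
      have h5 := mem_posSpan (K := K) (r := r) (β := ⟨_, h4⟩) (add_nonneg hβ.2 hγ.2)
      rcases hr.lie_eq_or β γ ⟨_, h4⟩ rfl with h6 | h6 <;> rw [h6]
      exacts [h5, neg_mem h5]

theorem eq_or_of_isRootMonomial {n : ℕ} {β : V → ℤ} {m : L} (h : IsRootMonomial Γ e n β m)
    (hβ : β ∈ roots Γ) : m = r ⟨β, hβ⟩ ∨ m = -r ⟨β, hβ⟩ := by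
  induction h with
  | gen x => exact Or.inl (hr.simple x _).symm
  | @lie x n β m hm hx ih =>
    have hβ' : β ∈ roots Γ := mem_roots_iff.2 hm.mem_normTwo
    have h1 := hr.lie_eq_or ⟨_, simpleRoot_mem_roots x⟩ ⟨β, hβ'⟩ ⟨_, hβ⟩ rfl
    rw [hr.simple] at h1
    rcases ih hβ' with h | h
    · rwa [h]
    · rw [h, lie_neg, neg_inj, neg_eq_iff_eq_neg]
      exact h1.symm

variable (K) in
/-- The subalgebra generated by the simple root vectors is spanned by the positive ones. -/
theorem lieSpan_toSubmodule :
    (LieSubalgebra.lieSpan K L (Set.range e)).toSubmodule = posSpan K r := by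
  apply le_antisymm
  · let P : LieSubalgebra K L := { posSpan K r with lie_mem' := hr.lie_mem_posSpan }
    have h : LieSubalgebra.lieSpan K L (Set.range e) ≤ P := LieSubalgebra.lieSpan_le.2 (by
      rintro _ ⟨x, rfl⟩
      rw [← hr.simple x (simpleRoot_mem_roots x)]
      exact mem_posSpan (simpleRoot_nonneg x))
    exact h
  · refine Submodule.span_le.2 ?_
    rintro _ ⟨β, hβ, rfl⟩
    -- Each positive root is reached by a monomial in the simple root vectors, which equals its root
    -- vector up to sign.
    obtain ⟨n, m, hm⟩ := IsRootMonomial.exists_of_nonneg e (mem_normTwo β) hβ.2 hp.out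
    have h : m ∈ LieSubalgebra.lieSpan K L (Set.range e) := hm.mem_lieSpan K
    rcases hr.eq_or_of_isRootMonomial hm β.2 with rfl | rfl
    · exact h
    · exact neg_mem_iff.1 h

theorem gen_comm {x y : V} (h : ¬ Γ.Adj x y) : ⁅e x, e y⁆ = 0 := by
  rcases eq_or_ne x y with rfl | hxy
  · exact lie_self _
  · rw [← hr.simple x (simpleRoot_mem_roots x), ← hr.simple y (simpleRoot_mem_roots y)]
    exact hr.lie_eq_zero _ _ (pairing_simpleRoot_of_not_adj hxy h).ge

/-- If the first bracket is nonzero, it is ± the root vector of α_x + β with ⟨α_x, β⟩ = -1, and this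
root pairs to 1 with α_x. -/
theorem gen_sandwich (x : V) {z : L} (hz : z ∈ posSpan K r) : ⁅e x, ⁅e x, z⁆⁆ = 0 := by
  induction hz using Submodule.span_induction with
  | zero => rw [lie_zero, lie_zero]
  | add a b _ _ ha hb => rw [lie_add, lie_add, ha, hb, add_zero]
  | smul c a _ ha => rw [lie_smul, lie_smul, ha, smul_zero]
  | mem a ha =>
    obtain ⟨β, hβ, rfl⟩ := ha
    have hx := simpleRoot_mem_roots (Γ := Γ) x
    rw [← hr.simple x hx]
    by_cases h : 0 ≤ pairing Γ (simpleRoot x) β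
    · rw [hr.lie_eq_zero ⟨_, hx⟩ β h, lie_zero]
    have h3 := pairing_eq_neg_one_of_neg (β := ⟨_, hx⟩) (simpleRoot_nonneg x) hβ.2 h
    have h4 := add_mem_roots h3
    have h5 : ⁅r ⟨_, hx⟩, r ⟨_, h4⟩⁆ = 0 := by
      refine hr.lie_eq_zero _ _ ?_
      rw [pairing_add_right, h3, pairing_simpleRoot_simpleRoot, cartanMatrix_self]
      decide
    rcases hr.lie_eq_or ⟨_, hx⟩ β ⟨_, h4⟩ rfl with h6 | h6 <;>
      simp only [h6, lie_neg, h5, neg_zero]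

/-- The homomorphism from the sandwich algebra to the positive part. -/
theorem exists_hom_lieSpan :
    ∃ φ : SandwichAlgebra K Γ →ₗ⁅K⁆ LieSubalgebra.lieSpan K L (Set.range e),
      ∀ x, (φ (sandwichGen K Γ x) : L) = e x := by
  obtain ⟨φ, hφ⟩ := exists_sandwichAlgebra_hom (Γ := Γ) K
    (fun x => (⟨e x, LieSubalgebra.subset_lieSpan ⟨x, rfl⟩⟩ :
      LieSubalgebra.lieSpan K L (Set.range e)))
    (fun x y h => Subtype.ext (hr.gen_comm h)) fun x z => Subtype.ext
      (hr.gen_sandwich (K := K) x (hr.lieSpan_toSubmodule K ▸ z.2))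
  exact ⟨φ, fun x => by rw [hφ]⟩

theorem exists_sandwichAlgebra_rootVector {φ : SandwichAlgebra K Γ →ₗ⁅K⁆ L}
    (hφ : ∀ x, φ (sandwichGen K Γ x) = e x) (β : roots Γ) (hβ : 0 ≤ (β : V → ℤ)) :
    ∃ v, φ v = r β ∧ ∃ n m, IsRootMonomial Γ (sandwichGen K Γ) n β m ∧ (m = v ∨ m = -v) := by
  obtain ⟨n, m, hm⟩ := IsRootMonomial.exists_of_nonneg (sandwichGen K Γ) (mem_normTwo β) hβ
    hp.out
  rcases hr.eq_or_of_isRootMonomial (hm.map φ (LieHom.map_lie φ) hφ) β.2 with h1 | h1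
  · exact ⟨m, h1, n, m, hm, Or.inl rfl⟩
  · exact ⟨-m, by rw [map_neg, h1, neg_neg], n, m, hm, Or.inr (neg_neg m).symm⟩

/-- One preimage per positive root spans L(0), since root monomials are unique up to sign, and its
images are independent. -/
theorem injective_and_posSpan_le_range (hK : (2 : K) ≠ 0) (hind : LinearIndependent K r)
    {φ : SandwichAlgebra K Γ →ₗ⁅K⁆ L} (hφ : ∀ x, φ (sandwichGen K Γ x) = e x) :
    Function.Injective φ ∧ posSpan K r ≤ LinearMap.range (φ : SandwichAlgebra K Γ →ₗ[K] L) := by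
  choose v hv n m hm hmv using fun β : {β : roots Γ // 0 ≤ (β : V → ℤ)} =>
    hr.exists_sandwichAlgebra_rootVector hφ β.1 β.2
  constructor
  · have hspan : Submodule.span K (Set.range v) = ⊤ := by
      rw [eq_top_iff, ← rootMonomialSpan_sandwichGen K hp.out hK]
      refine Submodule.span_le.2 ?_
      rintro z ⟨k, β, hz⟩
      have hβ : β ∈ roots Γ := mem_roots_iff.2 hz.mem_normTwo
      let b : {β : roots Γ // 0 ≤ (β : V → ℤ)} := ⟨⟨β, hβ⟩, hz.nonneg⟩
      have hb : v b ∈ Submodule.span K (Set.range v) := Submodule.subset_span ⟨b, rfl⟩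
      have hmb : m b ∈ Submodule.span K (Set.range v) := by
        rcases hmv b with h | h <;> rw [h]
        exacts [hb, neg_mem hb]
      rcases (hm b).eq_or_eq_neg (fun _ _ => sandwichGen_comm K) hp.out hz with h | h <;> rw [h]
      exacts [hmb, neg_mem hmb]
    refine injective_of_linearIndependent_comp (φ : SandwichAlgebra K Γ →ₗ[K] L) v hspan ?_
    have h := hind.comp (Subtype.val : {β : roots Γ // 0 ≤ (β : V → ℤ)} → roots Γ)
      Subtype.val_injective
    rwa [show r ∘ Subtype.val = φ ∘ v from (funext hv).symm] at h
  · refine Submodule.span_le.2 ?_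
    rintro _ ⟨β, hβ, rfl⟩
    exact ⟨v ⟨β, hβ.2⟩, hv ⟨β, hβ.2⟩⟩

theorem bijective_of_sandwichGen (hK : (2 : K) ≠ 0) (hind : LinearIndependent K r)
    {φ : SandwichAlgebra K Γ →ₗ⁅K⁆ LieSubalgebra.lieSpan K L (Set.range e)}
    (hφ : ∀ x, (φ (sandwichGen K Γ x) : L) = e x) : Function.Bijective φ := by
  obtain ⟨h1, h2⟩ := hr.injective_and_posSpan_le_range hK hind
    (φ := (LieSubalgebra.lieSpan K L (Set.range e)).incl.comp φ) hφ
  refine ⟨fun a b hab => h1 (congrArg Subtype.val hab), fun ⟨y, hy⟩ => ?_⟩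
  have hy' : y ∈ posSpan K r := hr.lieSpan_toSubmodule K ▸ hy
  obtain ⟨z, hz⟩ := h2 hy'
  exact ⟨z, Subtype.ext hz⟩

end IsRootVectorFamily

end RootVectors

/-! ### The Chevalley algebra -/

namespace ChevalleyBasis

variable {V : Type v} [DecidableEq V] [Fintype V] {Γ : SimpleGraph V} (c : ChevalleyBasis Γ)
  (K : Type u) [Field K]

/-- The Chevalley basis as a basis of the `ℤ`-form. -/
noncomputable def zBasis : Module.Basis (V ⊕ roots Γ) ℤ c.zForm :=
  .mk (v := fun i => (⟨c.vec i, Submodule.subset_span ⟨i, rfl⟩⟩ : c.zForm))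
    (LinearIndependent.of_comp c.zForm.toSubmodule.subtype
      (c.linearIndependent.restrict_scalars' ℤ)) (by
    rintro ⟨z, hz⟩ -
    change z ∈ Submodule.span ℤ (Set.range c.vec) at hz
    induction hz using Submodule.span_induction with
    | mem z hz =>
      obtain ⟨i, rfl⟩ := hz
      exact Submodule.subset_span ⟨i, rfl⟩
    | zero => exact zero_mem _
    | add a b _ _ ha hb => exact add_mem ha hb
    | smul n a _ ha => exact Submodule.smul_mem _ n ha)

theorem linearIndependent_rootVecK : LinearIndependent K (c.rootVecK K) := by
  have h := (c.zBasis.baseChange K).linearIndependent.comp _ Sum.inr_injective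
  convert h using 1
  funext β
  rw [Function.comp_apply, Module.Basis.baseChange_apply, zBasis, Module.Basis.mk_apply]
  rfl

theorem lie_rootVecK (β γ : roots Γ) : ⁅c.rootVecK K β, c.rootVecK K γ⁆ =
    (1 : K) ⊗ₜ[ℤ] ⁅(⟨c.rootVec β, c.rootVec_mem_zForm β⟩ : c.zForm),
      (⟨c.rootVec γ, c.rootVec_mem_zForm γ⟩ : c.zForm)⁆ := by
  rw [rootVecK, rootVecK, LieAlgebra.ExtendScalars.bracket_tmul, one_mul]

variable [hp : Fact (CartanPosDef Γ)]

theorem lie_rootVec_eq_zero {β γ : roots Γ} (h : 0 ≤ pairing Γ β γ) :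
    ⁅c.rootVec β, c.rootVec γ⁆ = 0 := by
  have hβ := mem_normTwo β
  have hγ := mem_normTwo γ
  have h0 : (β : V → ℤ) + γ ≠ 0 := fun h0 => by
    rw [eq_neg_of_add_eq_zero_left h0, pairing_neg_left, show pairing Γ γ γ = 2 from hγ] at h
    omega
  have hr : (β : V → ℤ) + γ ∉ roots Γ := fun hm => by
    have := (add_mem_normTwo_iff hβ hγ).1 (mem_roots_iff.1 hm)
    omega
  have hm := lie_mem_weightSpace Γ (c.rootVec_mem β) (c.rootVec_mem γ)
  have hb : weightSpace Γ ((β : V → ℤ) + γ) = ⊥ := by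
    by_contra hb
    exact hr ⟨h0, hb⟩
  rwa [hb, Submodule.mem_bot] at hm

/-- A positive p would make γ - β a root and force pairing 1, but the pairing is -1. -/
theorem lie_rootVec_eq_or {β γ δ : roots Γ} (h : (δ : V → ℤ) = β + γ) :
    ⁅c.rootVec β, c.rootVec γ⁆ = c.rootVec δ ∨ ⁅c.rootVec β, c.rootVec γ⁆ = -c.rootVec δ := by
  have hβ := mem_normTwo β
  have hγ := mem_normTwo γ
  have hδ := mem_normTwo δ
  rw [h, add_mem_normTwo_iff hβ hγ] at hδ
  obtain ⟨p, hp1, -, hp2⟩ := c.lie_add β γ δ h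
  have hp0 : p = 0 := by
    by_contra hp0
    have h1 := mem_normTwo ⟨_, hp1 1 (by omega)⟩
    simp only [one_smul] at h1
    rw [sub_mem_normTwo_iff hγ hβ, pairing_comm] at h1
    omega
  subst hp0
  simpa using hp2

/-- Together with linear independence, this is all that the final comparison uses about the
Chevalley basis; zeros and signs survive the base change. -/
theorem isRootVectorFamily : IsRootVectorFamily (c.rootVecK K) (c.E0 K) where
  simple x h := by simp only [rootVecK, E0, c.rootVec_simple x h]
  lie_eq_zero β γ h := by
    rw [lie_rootVecK]
    convert TensorProduct.tmul_zero c.zForm (1 : K)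
    exact Subtype.ext (c.lie_rootVec_eq_zero h)
  lie_eq_or β γ δ h := by
    rw [lie_rootVecK, rootVecK, ← TensorProduct.tmul_neg]
    exact (c.lie_rootVec_eq_or h).imp (fun h => congrArg _ (Subtype.ext h))
      fun h => congrArg _ (Subtype.ext h)

end ChevalleyBasis

end Sandwich

theorem mainTheorem2 {V : Type*} [Fintype V] [DecidableEq V] (Γ : SimpleGraph V)
    (hΓ : Sandwich.IsFiniteSimplyLacedDynkin Γ) (K : Type*) [Field K] (hK : (2 : K) ≠ 0) :
    Nonempty (Sandwich.ChevalleyBasis Γ) ∧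
    ∀ c : Sandwich.ChevalleyBasis Γ,
      (c.nPlus K).toSubmodule =
        Submodule.span K
          {v | ∃ β : Sandwich.roots Γ, (β : V → ℤ) ∈ Sandwich.posRoots Γ ∧ v = c.rootVecK K β} ∧
      ∃! φ : Sandwich.SandwichAlgebra K Γ →ₗ⁅K⁆ c.nPlus K,
        Function.Bijective φ ∧
        ∀ x : V, (φ (Sandwich.sandwichGen K Γ x) : c.ChevalleyAlgebra K) = c.E0 K x := by
  have : Fact (Sandwich.CartanPosDef Γ) := ⟨hΓ.cartanPosDef⟩
  refine ⟨Sandwich.nonempty_chevalleyBasis Γ, fun c => ?_⟩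
  have hr := c.isRootVectorFamily K
  refine ⟨hr.lieSpan_toSubmodule K, ?_⟩
  obtain ⟨φ, hφ⟩ := hr.exists_hom_lieSpan (K := K)
  refine ⟨φ, ⟨hr.bijective_of_sandwichGen hK (c.linearIndependent_rootVecK K) hφ, hφ⟩,
    fun ψ hψ => ?_⟩
  exact Sandwich.sandwichAlgebra_hom_ext K fun x => Subtype.ext ((hψ.2 x).trans (hφ x).symm)
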